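/- Let $n,d\ge 2$, $\{q_i\}_{i=1}^{2^d}=\{0,1\}^d$, $q_0=(\tfrac12,\dots,\tfrac12)\in\mathbb R^d$, and for $1\le i\le 2^d$, $1\le j\le n$ let $$F_{i,j}(x)=\frac{1}{2n-1}x+\frac{2n-2}{2n-1}\Big(\frac{n-j}{n-1}q_i+\frac{j-1}{n-1}q_0\Big).$$ Let $G_0=(V_0,E_0)$ be the complete graph on $V_0=\{q_i\}_{i=1}^{2^d}$, and for $m\ge1$ let $G_m=(V_m,E_m)$ with $V_m=\bigcup_{i,j}F_{i,j}V_{m-1}$ and $E_m=\{\{F_{i,j}x,F_{i,j}y\}:\{x,y\}\in E_{m-1},\,1\le i\le 2^d,\,1\le j\le n\}$. For $f:V_m\to\mathbb R$ put $\Delta_mf(x)=N_x^{-1}\sum_{y:\{x,y\}\in E_m}f(y)-f(x)$, where $N_x$ is the degree of $x$ in $G_m$. A real number $\lambda$ is a Neumann eigenvalue of $-\Delta_m$ if $-\Delta_mf=\lambda f$ at all points of $V_m$ (those of $V_0$ included) for some $f\ne0$; its multiplicity $M_{m,N}(\lambda)$ is the dimension of the space of all such $f$ (together with $0$), and $\sigma_{m,N}$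 is the set of Neumann eigenvalues. With $U_k$ the Chebyshev polynomials of the second kind and $t=1-(2^d-1)\lambda$, let $$R_{n,d}(\lambda)=1+(\lambda-1)U_{n-1}(t)^2+(t+\lambda+1)U_{n-1}(t)U_{n-2}(t)-t\,U_{n-2}(t)^2 .$$ Then for every $y\in[0,\frac{2^d}{2^d-1}]$ the equation $R_{n,d}(x)=y$ has exactly $2n-1$ real solutions $\psi_0(y)<\psi_1(y)<\dots<\psi_{2n-2}(y)$, and all of them lie in $[0,1]$. For a word $v=v_1\cdots v_k$ over $\{0,1,\dots,2n-2\}$ write $|v|=k$ and $\psi_v=\psi_{v_k}\circ\cdots\circ\psi_{v_1}$ ($\psi_\emptyset$ is the identity), and let $\Lambda_m$ be the set of such words with $|v|\le m$. For every $m\ge0$, $$\sigma_{m,N}=\Big\{\psi_v\big(\tfrac{2^d}{2^d-1}\big):v\in\Lambda_m,\ v=\emptyset\text{ or }v_1\in\{0,2,4,\dots,2n-4\}\Big\}\cup\Big\{\psi_v(0):v\in\Lambda_m,\ v=\emptyset\text{ or }v_1\in\{2,4,6,\dots,2n-2\}\Big\},$$ and the multiplicities are $$M_{m,N}\big(\psi_v(\tfrac{2^d}{2^d-1})\big)=(2^dn-2^d+1)^{m-|v|}(2^d-2)+1\quad\text{for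 }v\in\Lambda_m,\ v=\emptyset\text{ or }v_1\in\{0,2,\dots,2n-4\},$$ $$M_{m,N}(\psi_v(0))=1\quad\text{for }v\in\Lambda_m,\ v=\emptyset\text{ or }v_1\in\{2,4,\dots,2n-2\}.$$ -/

import Mathlib

noncomputable section

namespace Vicsek

/-- The vertex of the cube `[0,1]^d` with coordinates `ε ∈ {0,1}^d`. The corners of the cube are
indexed by their coordinates. -/
def corner {d : ℕ} (ε : Fin d → Fin 2) : Fin d → ℝ := fun k => ((ε k : ℕ) : ℝ)

/-- The center `(1/2, …, 1/2)` of the cube. -/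
def center (d : ℕ) : Fin d → ℝ := fun _ => 1 / 2

/-- The contraction `F_{i,j}` of the iterated function system (used for `1 ≤ j ≤ n`):
`F_{i,j}(x) = x/(2n-1) + (2n-2)/(2n-1) * ((n-j)/(n-1) q_i + (j-1)/(n-1) q_0)`. -/
def contraction (n : ℕ) {d : ℕ} (i : Fin d → Fin 2) (j : ℕ) (x : Fin d → ℝ) : Fin d → ℝ :=
  (1 / (2 * (n : ℝ) - 1)) • x +
    ((2 * (n : ℝ) - 2) / (2 * (n : ℝ) - 1)) •
      ((((n : ℝ) - j) / ((n : ℝ) - 1)) • corner i + (((j : ℝ) - 1) / ((n : ℝ) - 1)) • center d)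

/-- The vertex sets `V_m`. -/
def vertices (n d : ℕ) : ℕ → Set (Fin d → ℝ)
  | 0 => Set.range corner
  | m + 1 => ⋃ i : Fin d → Fin 2, ⋃ j ∈ Set.Icc 1 n, contraction n i j '' vertices n d m

/-- The edge sets `E_m`: `E_0` is the set of all pairs of distinct corners, and `E_{m+1}` is the
set of all images of edges of `E_m` under the contractions. -/
def edges (n d : ℕ) : ℕ → Set (Sym2 (Fin d → ℝ))
  | 0 => {e | ∃ i i' : Fin d → Fin 2, i ≠ i' ∧ e = s(corner i, corner i')}
  | m + 1 => ⋃ i : Fin d → Fin 2, ⋃ j ∈ Set.Icc 1 n, Sym2.map (contraction n i j) '' edges n d m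

/-- The level-`m` approximating graph `G_m = (V_m, E_m)`. -/
def graph (n d m : ℕ) : SimpleGraph (vertices n d m) :=
  (SimpleGraph.fromEdgeSet (edges n d m)).induce (vertices n d m)

theorem vertices_finite (n d m : ℕ) : (vertices n d m).Finite := by
  induction m with
  | zero => exact Set.finite_range _
  | succ m ih =>
    exact Set.finite_iUnion fun i => (Set.finite_Icc 1 n).biUnion fun j _ => ih.image _

instance (n d m : ℕ) : Finite (vertices n d m) := (vertices_finite n d m).to_subtype

instance (n d m : ℕ) : Fintype (vertices n d m) := Fintype.ofFinite _

open Classical in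
/-- The graph Laplacian `Δ_m f(x) = N_x⁻¹ ∑_{y ∼ x} f(y) - f(x)` on `l(V_m)`, where `N_x` is the
degree of `x` in `G_m`. -/
def laplacian (n d m : ℕ) : Module.End ℝ (vertices n d m → ℝ) where
  toFun f x :=
    (((graph n d m).degree x : ℝ)⁻¹ * (∑ y ∈ (graph n d m).neighborFinset x, f y)) - f x
  map_add' f g := by
    funext x
    simp only [Pi.add_apply, Finset.sum_add_distrib]
    ring
  map_smul' c f := by
    funext x
    simp only [Pi.smul_apply, smul_eq_mul, ← Finset.mul_sum, RingHom.id_apply]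
    ring

/-- The set `σ_{m,N}` of Neumann eigenvalues of `-Δ_m`: those real `μ` for which some nonzero `f`
satisfies `-Δ_m f(x) = μ f(x)` at every `x ∈ V_m`, boundary points included. -/
def neumannSpectrum (n d m : ℕ) : Set ℝ :=
  {μ | ∃ f : vertices n d m → ℝ, f ≠ 0 ∧ ∀ x, -(laplacian n d m f x) = μ * f x}

/-- The multiplicity of `μ` as a Neumann eigenvalue of `-Δ_m`: the dimension of the space of all
`f` with `-Δ_m f = μ f` on the whole of `V_m`. -/
def neumannMultiplicity (n d m : ℕ) (μ : ℝ) : ℕ :=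
  Module.finrank ℝ (Module.End.eigenspace (-laplacian n d m) μ)

open Polynomial in
/-- The substitution `t = 1 - (2^d - 1) λ`, as a polynomial in `λ`. -/
def tPoly (d : ℕ) : ℝ[X] := 1 - C ((2 : ℝ) ^ d - 1) * X

open Polynomial in
/-- The spectral decimation polynomial
`R_{n,d}(λ) = 1 + (λ-1) U_{n-1}(t)² + (t+λ+1) U_{n-1}(t) U_{n-2}(t) - t U_{n-2}(t)²`, where
`t = 1 - (2^d-1) λ` and `U` denotes the Chebyshev polynomials of the second kind. -/
def decimation (n d : ℕ) : ℝ[X] :=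
  1 + (X - 1) * ((Chebyshev.U ℝ ((n : ℤ) - 1)).comp (tPoly d)) ^ 2
    + (tPoly d + X + 1) * (Chebyshev.U ℝ ((n : ℤ) - 1)).comp (tPoly d)
        * (Chebyshev.U ℝ ((n : ℤ) - 2)).comp (tPoly d)
    - tPoly d * ((Chebyshev.U ℝ ((n : ℤ) - 2)).comp (tPoly d)) ^ 2

/-- The inverse branch `ψ_l`: `ψ_0(y), ψ_1(y), …` are the real solutions `x` of `R_{n,d}(x) = y`
listed in increasing order (with the value `0` when there is no `l`-th solution). -/
def branch (n d l : ℕ) (y : ℝ) : ℝ :=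
  ((decimation n d - Polynomial.C y).roots.toFinset.sort (· ≤ ·)).getD l 0

/-- The composition `ψ_v = ψ_{v_k} ∘ ⋯ ∘ ψ_{v_1}` for a word `v = v_1 ⋯ v_k` over the alphabet
`{0, …, 2n-2}`; `ψ_∅` is the identity. -/
def branchWord (n d : ℕ) (v : List (Fin (2 * n - 1))) (y : ℝ) : ℝ :=
  v.foldl (fun x l => branch n d l x) y

/-- `Λ_m`: the words of length at most `m` over the alphabet `{0, …, 2n-2}`. -/
def words (n m : ℕ) : Set (List (Fin (2 * n - 1))) := {v | v.length ≤ m}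

/-- The words that are empty or have first letter `v_1` in `{0, 2, 4, …, 2n-4}`. -/
def firstKind (n : ℕ) : Set (List (Fin (2 * n - 1))) :=
  {v | ∀ a ∈ v.head?, Even (a : ℕ) ∧ (a : ℕ) ≤ 2 * n - 4}

/-- The words that are empty or have first letter `v_1` in `{2, 4, 6, …, 2n-2}`. -/
def secondKind (n : ℕ) : Set (List (Fin (2 * n - 1))) :=
  {v | ∀ a ∈ v.head?, Even (a : ℕ) ∧ 2 ≤ (a : ℕ)}

end Vicsek

end

noncomputable section

namespace Vicsek

/-! Only lower bounds for multiplicities are proved directly; a dimension count makes them sharp.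

Two eigenvalues are visible at every level. Constants give `0`. Written cell by cell
(`mem_eigenspace_iff`), the eigenvalue equation at `2^d/(2^d-1)` loses its `f x` term, so every
function with zero sum over each cell is an eigenfunction; rank-nullity then yields the multiplicity
of `le_multiplicity_top`.

Other eigenvalues come from spectral decimation. Fix the values of a function at the corners of a
cell and extend them into the subdivided cell so that the eigenvalue equation for `x` holds at all
new vertices. Along each arm this is a linear recurrence solved by Chebyshev values; the matching
conditions at the corners and at the centre are solvable when `sumFactor` and `topFactor` do not
vanish at `x`. The defect left at the corners is then proportional to the defect of the original
function for `R(x)` (`defect_eq`, `sum_localExt_defect`). Hence the multiplicity of `R(x)` at level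
`m` is at most that of `x` at level `m + 1` (`multiplicity_decimation_le`).

The inverse branches of `R` are controlled by points where `t = cos (k π / (2n-1))`: there `R` is
alternately `0` and `2^d/(2^d-1)`. The intermediate value theorem and two factorizations of `R` give
a solution of `R(x) = y` in each of `2n-1` intervals, and the degree allows no more (`branch_spec`).
The admissible words are those whose iterated preimages avoid the exceptional zeros, the redundant
`ψ_0(0) = 0` being left out; distinct words or seeds give distinct values (`branchWord_injective`).

The lower bounds sum to the number of vertices (`sum_multiplicities`, `ncard_vertices`). Since
eigenspaces are independent, every bound is an equality and no eigenvalue is missing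
(`spectrum_and_multiplicity`). -/

section

open Polynomial

/-! ### Chebyshev values and two factorizations of the decimation polynomial. -/

/-- The substituted variable `t = 1 - (2^d - 1) x`. -/
def tVal (d : ℕ) (x : ℝ) : ℝ := 1 - ((2 : ℝ) ^ d - 1) * x

/-- The value `U_k(t)` at `t = 1 - (2^d - 1) x`. -/
def chebU (d : ℕ) (k : ℤ) (x : ℝ) : ℝ := (Chebyshev.U ℝ k).eval (tVal d x)

theorem chebU_add_one (d : ℕ) (k : ℤ) (x : ℝ) :
    chebU d (k + 1) x = 2 * tVal d x * chebU d k x - chebU d (k - 1) x := by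
  simp [chebU, Chebyshev.U_add_one]

theorem chebU_neg_one (d : ℕ) (x : ℝ) : chebU d (-1) x = 0 := by simp [chebU]

theorem chebU_zero (d : ℕ) (x : ℝ) : chebU d 0 x = 1 := by simp [chebU]

theorem continuous_tVal (d : ℕ) : Continuous (tVal d) := by unfold tVal; fun_prop

theorem continuous_chebU (d : ℕ) (k : ℤ) : Continuous (chebU d k) :=
  (Polynomial.continuous _).comp (continuous_tVal d)

/-- The Pell-type identity for consecutive Chebyshev values. -/
theorem chebU_pell (d n : ℕ) (x : ℝ) :
    chebU d (n - 1) x ^ 2 - 2 * tVal d x * chebU d (n - 1) x * chebU d (n - 2) x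
      + chebU d (n - 2) x ^ 2 = 1 := by
  induction n with
  | zero =>
    have h := chebU_add_one d (-1) x
    norm_num [chebU_neg_one, chebU_zero] at h ⊢
    rw [show chebU d (-2) x = -1 by linarith]; norm_num
  | succ n ih =>
    have h := chebU_add_one d (n - 1) x
    have e1 : ((n : ℤ) - 1 + 1) = (n : ℤ) + 1 - 1 := by ring
    have e2 : ((n : ℤ) - 1 - 1) = (n : ℤ) - 2 := by ring
    have e3 : ((n : ℤ) + 1 - 2) = (n : ℤ) - 1 := by ring
    rw [e1, e2] at h
    push_cast
    rw [e3, h]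
    linear_combination ih

theorem decimation_eval (n d : ℕ) (x : ℝ) :
    (decimation n d).eval x = 1 + (x - 1) * chebU d (n - 1) x ^ 2
      + (tVal d x + x + 1) * chebU d (n - 1) x * chebU d (n - 2) x
      - tVal d x * chebU d (n - 2) x ^ 2 := by
  simp [decimation, tPoly, chebU, tVal]

/-- The factor `U_{n-1} + U_{n-2}`, whose zeros are exceptional for the decimation. -/
def sumFactor (n d : ℕ) (x : ℝ) : ℝ := chebU d (n - 1) x + chebU d (n - 2) x

/-- The factor `U_{n-1} - U_{n-2}` of `2^d - (2^d - 1) R`. -/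
def diffFactor (n d : ℕ) (x : ℝ) : ℝ := chebU d (n - 1) x - chebU d (n - 2) x

/-- The factor of `2^d - (2^d - 1) R` complementary to `diffFactor`. -/
def topFactor (n d : ℕ) (x : ℝ) : ℝ :=
  ((2 : ℝ) ^ d - 1 + tVal d x) * chebU d (n - 1) x
    - (1 + ((2 : ℝ) ^ d - 1) * tVal d x) * chebU d (n - 2) x

/-- The factor of `(2^d - 1) R` complementary to `sumFactor`. -/
def zeroFactor (n d : ℕ) (x : ℝ) : ℝ :=
  (2 : ℝ) ^ d * (chebU d (n - 1) x - (1 + 2 * tVal d x) * chebU d (n - 2) x)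
    - ((2 : ℝ) ^ d - 1 + tVal d x) * diffFactor n d x
    + (2 : ℝ) ^ d * (1 + tVal d x) * chebU d (n - 2) x

/-- The Pell identity turns the constant term into a quadratic form in the two Chebyshev values, and
the resulting form splits. The preimages of `2^d/(2^d-1)` thus separate into zeros of `diffFactor`,
which are explicit, and zeros of `topFactor`, which are exceptional for the extension. -/
theorem decimation_top (n d : ℕ) (x : ℝ) :
    ((2 : ℝ) ^ d - 1) * (decimation n d).eval x = (2 : ℝ) ^ d - diffFactor n d x * topFactor n d x := by
  have h := chebU_pell d n x
  have ht : ((2 : ℝ) ^ d - 1) * x = 1 - tVal d x := by simp [tVal]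
  rw [decimation_eval, diffFactor, topFactor]
  linear_combination h + (chebU d (n - 1) x ^ 2 + chebU d (n - 1) x * chebU d (n - 2) x) * ht

theorem decimation_zero (n d : ℕ) (x : ℝ) :
    ((2 : ℝ) ^ d - 1) * (decimation n d).eval x = sumFactor n d x * zeroFactor n d x := by
  have h := chebU_pell d n x
  rw [decimation_top, diffFactor, topFactor, sumFactor, zeroFactor, diffFactor]
  linear_combination -(2 : ℝ) ^ d * h

/-- Serves twice: it excludes common zeros of the two factors away from `t = 1`, and it gives the
sign of `topFactor` at the zeros of `diffFactor`. -/
theorem topFactor_of_diffFactor (n d : ℕ) (x : ℝ) (h : diffFactor n d x = 0) :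
    topFactor n d x = ((2 : ℝ) ^ d - 2) * (1 - tVal d x) * chebU d (n - 1) x := by
  rw [diffFactor] at h
  rw [topFactor]
  linear_combination (1 + ((2 : ℝ) ^ d - 1) * tVal d x) * h

theorem zeroFactor_of_sumFactor (n d : ℕ) (x : ℝ) (h : sumFactor n d x = 0) :
    zeroFactor n d x = -(((2 : ℝ) ^ d - 2) * (1 - tVal d x) * chebU d (n - 1) x) := by
  rw [sumFactor] at h
  rw [zeroFactor, diffFactor]
  linear_combination (2 ^ d - 1 + tVal d x - 2 ^ d * tVal d x) * h

theorem continuous_topFactor (n d : ℕ) : Continuous (topFactor n d) := by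
  have := continuous_tVal d
  have := continuous_chebU d (n - 1)
  have := continuous_chebU d (n - 2)
  unfold topFactor; fun_prop

theorem continuous_zeroFactor (n d : ℕ) : Continuous (zeroFactor n d) := by
  have := continuous_tVal d
  have := continuous_chebU d (n - 1)
  have := continuous_chebU d (n - 2)
  unfold zeroFactor diffFactor; fun_prop

theorem four_le_two_pow {d : ℕ} (hd : 2 ≤ d) : (4 : ℝ) ≤ 2 ^ d := by
  calc (4 : ℝ) = 2 ^ 2 := by norm_num
    _ ≤ 2 ^ d := by gcongr; norm_num

/-- The largest eigenvalue `2^d / (2^d - 1)` of the complete graph. -/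
def topValue (d : ℕ) : ℝ := (2 : ℝ) ^ d / ((2 : ℝ) ^ d - 1)

theorem mul_topValue {d : ℕ} (hd : 2 ≤ d) : ((2 : ℝ) ^ d - 1) * topValue d = 2 ^ d := by
  have := four_le_two_pow hd
  rw [topValue]
  field_simp [show (2 : ℝ) ^ d - 1 ≠ 0 by linarith]

theorem one_lt_topValue {d : ℕ} (hd : 2 ≤ d) : 1 < topValue d := by
  have := four_le_two_pow hd
  rw [topValue, lt_div_iff₀] <;> linarith

theorem topValue_lt_two {d : ℕ} (hd : 2 ≤ d) : topValue d < 2 := by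
  have := four_le_two_pow hd
  rw [topValue, div_lt_iff₀] <;> linarith

theorem decimation_eq_topValue_iff {d : ℕ} (hd : 2 ≤ d) (n : ℕ) (x : ℝ) :
    (decimation n d).eval x = topValue d ↔ diffFactor n d x = 0 ∨ topFactor n d x = 0 := by
  have h4 := four_le_two_pow hd
  have h := decimation_top n d x
  have h' := mul_topValue hd
  rw [← mul_eq_zero]
  constructor
  · intro e; rw [e] at h; linarith
  · intro e
    have h3 : ((2 : ℝ) ^ d - 1) ≠ 0 := by linarith
    exact mul_left_cancel₀ h3 (by linarith)

theorem decimation_eq_zero_iff {d : ℕ} (hd : 2 ≤ d) (n : ℕ) (x : ℝ) :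
    (decimation n d).eval x = 0 ↔ sumFactor n d x = 0 ∨ zeroFactor n d x = 0 := by
  have h4 := four_le_two_pow hd
  have h := decimation_zero n d x
  have h3 : ((2 : ℝ) ^ d - 1) ≠ 0 := by linarith
  rw [← mul_eq_zero, ← h, mul_eq_zero]
  simp [h3]

theorem chebU_ne_zero_of_sumFactor {n d : ℕ} {x : ℝ} (h : sumFactor n d x = 0) :
    chebU d (n - 1) x ≠ 0 := by
  intro e
  have hp := chebU_pell d n x
  rw [sumFactor, e, zero_add] at h
  rw [e, h] at hp
  norm_num at hp

theorem chebU_ne_zero_of_diffFactor {n d : ℕ} {x : ℝ} (h : diffFactor n d x = 0) :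
    chebU d (n - 1) x ≠ 0 := by
  intro e
  have hp := chebU_pell d n x
  rw [diffFactor, e, zero_sub, neg_eq_zero] at h
  rw [e, h] at hp
  norm_num at hp

theorem tVal_ne_one {d : ℕ} (hd : 2 ≤ d) {x : ℝ} (hx : x ≠ 0) : 1 - tVal d x ≠ 0 := by
  have h4 := four_le_two_pow hd
  rw [tVal]
  have : ((2 : ℝ) ^ d - 1) * x ≠ 0 := mul_ne_zero (by linarith) hx
  intro h; apply this; linarith

/-- At zeros of `diffFactor` other than `0` the decimation is not exceptional. -/
theorem regular_of_diffFactor {n d : ℕ} (hd : 2 ≤ d) {x : ℝ} (hx : x ≠ 0)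
    (h : diffFactor n d x = 0) : sumFactor n d x ≠ 0 ∧ topFactor n d x ≠ 0 := by
  have h4 := four_le_two_pow hd
  have ha := chebU_ne_zero_of_diffFactor h
  constructor
  · intro e
    rw [sumFactor] at e
    rw [diffFactor] at h
    exact ha (by linarith)
  · rw [topFactor_of_diffFactor n d x h]
    exact mul_ne_zero (mul_ne_zero (by linarith) (tVal_ne_one hd hx)) ha

theorem sumFactor_ne_zero_of_zeroFactor {n d : ℕ} (hd : 2 ≤ d) {x : ℝ} (hx : x ≠ 0)
    (h : zeroFactor n d x = 0) : sumFactor n d x ≠ 0 := by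
  intro e
  have h4 := four_le_two_pow hd
  rw [zeroFactor_of_sumFactor n d x e, neg_eq_zero] at h
  exact mul_ne_zero (mul_ne_zero (by linarith) (tVal_ne_one hd hx))
    (chebU_ne_zero_of_sumFactor e) h

theorem decimation_eval_zero (n d : ℕ) : (decimation n d).eval 0 = 0 := by
  rw [decimation_eval]
  have ht : tVal d 0 = 1 := by simp [tVal]
  simp only [chebU, ht, Chebyshev.U_eval_one]
  push_cast; ring

/-- An upper bound suffices, because `2n-1` distinct solutions are exhibited separately. -/
theorem natDegree_decimation_le {n d : ℕ} (hn : 2 ≤ n) : (decimation n d).natDegree ≤ 2 * n - 1 := by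
  have ht : (tPoly d).natDegree ≤ 1 := by unfold tPoly; compute_degree
  have hU (k : ℕ) : ((Chebyshev.U ℝ (k : ℤ)).comp (tPoly d)).natDegree ≤ k := by
    refine natDegree_comp_le.trans ?_
    rw [Chebyshev.natDegree_U_natCast]
    nlinarith
  have h1 := hU (n - 1)
  have h2 := hU (n - 2)
  rw [show ((n - 1 : ℕ) : ℤ) = (n : ℤ) - 1 by omega] at h1
  rw [show ((n - 2 : ℕ) : ℤ) = (n : ℤ) - 2 by omega] at h2
  have h3 : (X - 1 : ℝ[X]).natDegree ≤ 1 := by compute_degree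
  have h4 : (tPoly d + X + 1 : ℝ[X]).natDegree ≤ 1 := by
    refine natDegree_add_le_of_degree_le (natDegree_add_le_of_degree_le ht ?_) ?_
    · simp
    · simp
  unfold decimation
  refine (natDegree_sub_le_of_le (natDegree_add_le_of_degree_le (natDegree_add_le_of_degree_le
    ((natDegree_one (R := ℝ)).le.trans (Nat.zero_le _)) ?_) ?_) ?_).trans (max_self (2 * n - 1)).le
  · exact (natDegree_mul_le_of_le h3 (natDegree_pow_le_of_le 2 h1)).trans (by omega)
  · exact (natDegree_mul_le_of_le (natDegree_mul_le_of_le h4 h1) h2).trans (by omega)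
  · exact (natDegree_mul_le_of_le ht (natDegree_pow_le_of_le 2 h2)).trans (by omega)

/-- For `t ≤ -1` the values `(-1)^k U_k(t)` are at least `1` and strictly increasing in `k`. -/
theorem chebU_growth {d : ℕ} {x : ℝ} (hx : tVal d x ≤ -1) (k : ℕ) :
    1 ≤ (-1) ^ k * chebU d k x ∧
      (-1) ^ k * chebU d k x + 1 ≤ (-1) ^ (k + 1) * chebU d (k + 1) x := by
  induction k with
  | zero =>
    have h := chebU_add_one d 0 x
    norm_num [chebU_neg_one, chebU_zero] at h ⊢
    rw [h]; linarith
  | succ k ih =>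
    obtain ⟨h1, h2⟩ := ih
    have h := chebU_add_one d (k + 1) x
    push_cast
    rw [h, show (k : ℤ) + 1 - 1 = k by ring]
    refine ⟨by linarith, ?_⟩
    set p := (-1 : ℝ) ^ k * chebU d k x
    set q := (-1 : ℝ) ^ (k + 1) * chebU d (k + 1) x with hq
    have e : (-1 : ℝ) ^ (k + 1 + 1) * (2 * tVal d x * chebU d (k + 1) x - chebU d k x)
        = -2 * tVal d x * q - p := by
      simp only [p, q]; ring
    rw [e]
    nlinarith

theorem tVal_one_le {d : ℕ} (hd : 2 ≤ d) : tVal d 1 ≤ -1 := by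
  have h4 := four_le_two_pow hd
  rw [tVal]; linarith

/-- Signs at the right end point `1`. -/
theorem signs_at_one {n d : ℕ} (hn : 2 ≤ n) (hd : 2 ≤ d) :
    topValue d < (decimation n d).eval 1 ∧ 0 < (-1) ^ (n - 1) * sumFactor n d 1 ∧
      0 < (-1) ^ (n - 1) * diffFactor n d 1 := by
  obtain ⟨k, rfl⟩ := Nat.exists_eq_add_of_le hn
  have h4 := four_le_two_pow hd
  obtain ⟨h1, h2⟩ := chebU_growth (tVal_one_le hd) k
  have e1 : (((2 + k : ℕ) : ℤ) - 1) = k + 1 := by push_cast; ring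
  have e2 : (((2 + k : ℕ) : ℤ) - 2) = k := by push_cast; ring
  have e3 : 2 + k - 1 = k + 1 := by omega
  rw [decimation_eval, sumFactor, diffFactor, e1, e2, e3]
  have hp : ((-1 : ℝ) ^ k) ^ 2 = 1 := by rw [← pow_mul, mul_comm, pow_mul]; norm_num
  set s := (-1 : ℝ) ^ k
  set a := chebU d (k + 1) 1
  set b := chebU d k 1
  have es : (-1 : ℝ) ^ (k + 1) = s * -1 := pow_succ _ _
  rw [es] at h2 ⊢
  refine ⟨?_, by linarith, by linarith⟩
  -- The square of `a` drops out at `x = 1`, leaving `1 + (2^d - 4)(-ab) + (2^d - 2) b² ≥ 3`, while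
  -- the largest admissible `y` is below `2`.
  have ht : tVal d 1 = 2 - 2 ^ d := by rw [tVal]; ring
  rw [ht]
  have hab : 1 ≤ -(a * b) := by nlinarith [mul_le_mul h1 (show 1 ≤ s * -1 * a by linarith) zero_le_one (by linarith)]
  have hb : 1 ≤ b ^ 2 := by nlinarith [mul_le_mul h1 h1 zero_le_one (by linarith)]
  have := topValue_lt_two hd
  nlinarith [mul_nonneg (show (0:ℝ) ≤ 2 ^ d - 4 by linarith) (show 0 ≤ -(a * b) by linarith),
    mul_le_mul_of_nonneg_left hb (show (0:ℝ) ≤ 2 ^ d - 2 by linarith)]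

/-! ### Nodes and the signs of the factors at them. -/

/-- The nodes `(1 - cos (k π / (2n-1))) / (2^d - 1)`, `0 ≤ k ≤ 2n-2`, followed by the end point `1`;
they separate the inverse branches of the decimation polynomial. -/
def node (n d k : ℕ) : ℝ :=
  if k ≤ 2 * n - 2 then (1 - Real.cos (k * Real.pi / (2 * n - 1))) / (2 ^ d - 1) else 1

theorem node_zero (n d : ℕ) : node n d 0 = 0 := by simp [node]

theorem node_last {n d : ℕ} (hn : 2 ≤ n) : node n d (2 * n - 1) = 1 := by
  rw [node, if_neg (by omega)]

theorem tVal_node {n d k : ℕ} (hd : 2 ≤ d) (hk : k ≤ 2 * n - 2) :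
    tVal d (node n d k) = Real.cos (k * Real.pi / (2 * n - 1)) := by
  have := four_le_two_pow hd
  rw [tVal, node, if_pos hk]
  field_simp [show (2 : ℝ) ^ d - 1 ≠ 0 by linarith]
  ring

theorem node_angle {n k : ℕ} (hn : 2 ≤ n) (hk : k ≤ 2 * n - 2) :
    0 ≤ k * Real.pi / (2 * (n : ℝ) - 1) ∧ k * Real.pi / (2 * (n : ℝ) - 1) < Real.pi := by
  have hn' : (2 : ℝ) ≤ n := by exact_mod_cast hn
  have hk' : (k : ℝ) + 2 ≤ 2 * n := by exact_mod_cast (by omega : k + 2 ≤ 2 * n)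
  have := Real.pi_pos
  refine ⟨div_nonneg (by positivity) (by linarith), ?_⟩
  rw [div_lt_iff₀ (by linarith)]
  nlinarith

theorem node_lt_succ {n d k : ℕ} (hn : 2 ≤ n) (hd : 2 ≤ d) (hk : k < 2 * n - 1) :
    node n d k < node n d (k + 1) := by
  have h4 := four_le_two_pow hd
  have hn' : (2 : ℝ) ≤ n := by exact_mod_cast hn
  have := Real.pi_pos
  have ha := node_angle hn (show k ≤ 2 * n - 2 by omega)
  by_cases hk' : k + 1 ≤ 2 * n - 2
  · have hb := node_angle hn hk'
    rw [node, node, if_pos (by omega), if_pos hk']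
    apply div_lt_div_of_pos_right _ (by linarith)
    have := Real.cos_lt_cos_of_nonneg_of_le_pi ha.1 hb.2.le
      (div_lt_div_of_pos_right (by push_cast; nlinarith) (by linarith))
    linarith
  · rw [node, node, if_pos (by omega), if_neg hk']
    rw [div_lt_one (by linarith)]
    have := Real.neg_one_le_cos (k * Real.pi / (2 * (n : ℝ) - 1))
    linarith

theorem node_strictMonoOn {n d : ℕ} (hn : 2 ≤ n) (hd : 2 ≤ d) :
    StrictMonoOn (node n d) (Set.Iic (2 * n - 1)) := by
  have key : ∀ k l, k + l + 1 ≤ 2 * n - 1 → node n d k < node n d (k + l + 1) := by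
    intro k l
    induction l with
    | zero => intro h; exact node_lt_succ hn hd (by omega)
    | succ l ih =>
      intro h
      exact (ih (by omega)).trans (node_lt_succ hn hd (by omega))
  intro k _ l hl hkl
  obtain ⟨m, rfl⟩ := Nat.exists_eq_add_of_lt hkl
  exact key k m hl

theorem node_monotone {n d k l : ℕ} (hn : 2 ≤ n) (hd : 2 ≤ d) (hkl : k ≤ l) (hl : l ≤ 2 * n - 1) :
    node n d k ≤ node n d l :=
  (node_strictMonoOn hn hd).monotoneOn (hkl.trans hl) hl hkl

/-- Since `(2n-1)θ = kπ`, the sines of `nθ` and `(n-1)θ` agree up to sign. Writing `nθ = kπ/2 + θ/2`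
reduces the sign of `sin (nθ)` to that of `sin (θ/2)` or `cos (θ/2)`, according to the parity of
`k`. -/
theorem node_sin {n d k : ℕ} (hn : 2 ≤ n) (hd : 2 ≤ d) (hk : k ≤ 2 * n - 2) (hk1 : 1 ≤ k) :
    chebU d (n - 2) (node n d k) = -((-1) ^ k * chebU d (n - 1) (node n d k)) ∧
      0 < (-1) ^ (k / 2) * chebU d (n - 1) (node n d k) := by
  have hn' : (2 : ℝ) ≤ n := by exact_mod_cast hn
  obtain ⟨h0, h1⟩ := node_angle hn hk
  have hθ := tVal_node (n := n) hd hk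
  rw [chebU, chebU, hθ]
  set θ := (k : ℝ) * Real.pi / (2 * (n : ℝ) - 1) with hdef
  have hpi := Real.pi_pos
  have h2 : 0 < θ := by
    apply div_pos _ (by linarith)
    have : (1 : ℝ) ≤ k := by exact_mod_cast hk1
    positivity
  have hs : 0 < Real.sin θ := Real.sin_pos_of_pos_of_lt_pi h2 h1
  have hU1 := Chebyshev.U_real_cos θ (n - 1)
  have hU2 := Chebyshev.U_real_cos θ (n - 2)
  have hk' : (k : ℝ) * Real.pi = (2 * n - 1) * θ := by
    rw [hdef]; field_simp [show (2 * (n : ℝ) - 1) ≠ 0 by linarith]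
  push_cast at hU1 hU2
  rw [show ((n : ℝ) - 1 + 1) * θ = n * θ by ring] at hU1
  rw [show ((n : ℝ) - 2 + 1) * θ = k * Real.pi - n * θ by rw [hk']; ring,
    Real.sin_nat_mul_pi_sub] at hU2
  constructor
  · apply mul_right_cancel₀ hs.ne'
    rw [hU2, neg_mul, mul_assoc, hU1]
  · suffices h : 0 < (-1) ^ (k / 2) * Real.sin (n * θ) by
      rw [← hU1, ← mul_assoc] at h
      exact (mul_pos_iff_of_pos_right hs).1 h
    have hn2 : n * θ = k * Real.pi / 2 + θ / 2 := by rw [hk']; ring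
    have hsq (j : ℕ) : ((-1 : ℝ) ^ j) * (-1) ^ j = 1 := by rw [← mul_pow]; norm_num
    rw [hn2]
    rcases Nat.even_or_odd' k with ⟨j, hj | hj⟩
    · have e : k / 2 = j := by omega
      rw [e, hj]
      push_cast
      rw [show 2 * (j : ℝ) * Real.pi / 2 + θ / 2 = θ / 2 + j * Real.pi by ring,
        Real.sin_add_nat_mul_pi, ← mul_assoc, hsq, one_mul]
      exact Real.sin_pos_of_pos_of_lt_pi (by linarith) (by linarith)
    · have e : k / 2 = j := by omega
      rw [e, hj]
      push_cast
      rw [show (2 * (j : ℝ) + 1) * Real.pi / 2 + θ / 2 = (θ / 2 + Real.pi / 2) + j * Real.pi by ring,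
        Real.sin_add_nat_mul_pi, ← mul_assoc, hsq, one_mul, Real.sin_add_pi_div_two]
      exact Real.cos_pos_of_mem_Ioo ⟨by linarith, by linarith⟩

theorem sumFactor_node {n d k : ℕ} (hn : 2 ≤ n) (hd : 2 ≤ d) (hk : k ≤ 2 * n - 2) (hk1 : 1 ≤ k)
    (he : Even k) : sumFactor n d (node n d k) = 0 ∧
      diffFactor n d (node n d k) = 2 * chebU d (n - 1) (node n d k) := by
  have h := (node_sin hn hd hk hk1).1
  rw [he.neg_one_pow, one_mul] at h
  rw [sumFactor, diffFactor, h]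
  constructor <;> ring

theorem diffFactor_node {n d k : ℕ} (hn : 2 ≤ n) (hd : 2 ≤ d) (hk : k ≤ 2 * n - 2)
    (ho : Odd k) : diffFactor n d (node n d k) = 0 ∧
      sumFactor n d (node n d k) = 2 * chebU d (n - 1) (node n d k) := by
  have h := (node_sin hn hd hk ho.pos).1
  rw [ho.neg_one_pow, neg_one_mul, neg_neg] at h
  rw [sumFactor, diffFactor, h]
  constructor <;> ring

theorem decimation_node_even {n d k : ℕ} (hn : 2 ≤ n) (hd : 2 ≤ d) (hk : k ≤ 2 * n - 2)
    (he : Even k) : (decimation n d).eval (node n d k) = 0 := by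
  rcases Nat.eq_zero_or_pos k with rfl | h
  · rw [node_zero, decimation_eval_zero]
  · exact (decimation_eq_zero_iff hd n _).2 (Or.inl (sumFactor_node hn hd hk h he).1)

theorem decimation_node_odd {n d k : ℕ} (hn : 2 ≤ n) (hd : 2 ≤ d) (hk : k ≤ 2 * n - 2)
    (ho : Odd k) : (decimation n d).eval (node n d k) = topValue d :=
  (decimation_eq_topValue_iff hd n _).2 (Or.inl (diffFactor_node hn hd hk ho).1)

theorem node_pos {n d k : ℕ} (hn : 2 ≤ n) (hd : 2 ≤ d) (hk : k ≤ 2 * n - 1) (hk1 : 1 ≤ k) :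
    0 < node n d k := by
  have := node_strictMonoOn (n := n) hn hd (show 0 ∈ Set.Iic (2 * n - 1) by simp) hk hk1
  rwa [node_zero] at this

theorem one_sub_tVal_pos {d : ℕ} (hd : 2 ≤ d) {x : ℝ} (hx : 0 < x) : 0 < 1 - tVal d x := by
  have h4 := four_le_two_pow hd
  rw [tVal]
  nlinarith

/-- At even nodes `R` vanishes, so the product of `diffFactor` and `topFactor` is the positive
number `2^d`; at odd nodes `topFactor` is a positive multiple of `U_{n-1}`. In both cases it has the
sign of `U_{n-1}`. -/
theorem topFactor_node_sign {n d k : ℕ} (hn : 2 ≤ n) (hd : 2 ≤ d) (hk : k ≤ 2 * n - 2)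
    (hk1 : 1 ≤ k) : 0 < (-1) ^ (k / 2) * topFactor n d (node n d k) := by
  have h4 := four_le_two_pow hd
  have ha := (node_sin hn hd hk hk1).2
  rcases Nat.even_or_odd k with he | ho
  · have h := decimation_top n d (node n d k)
    rw [decimation_node_even hn hd hk he, (sumFactor_node hn hd hk hk1 he).2] at h
    set a := chebU d (n - 1) (node n d k)
    set q := topFactor n d (node n d k)
    have hsq : ((-1 : ℝ) ^ (k / 2)) * (-1) ^ (k / 2) = 1 := by rw [← mul_pow]; norm_num
    set s := (-1 : ℝ) ^ (k / 2)
    have : (s * a) * (s * q) = 2 ^ d / 2 := by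
      linear_combination a * q * hsq + h / 2
    exact (mul_pos_iff_of_pos_left ha).1 (by rw [this]; positivity)
  · rw [topFactor_of_diffFactor n d _ (diffFactor_node hn hd hk ho).1]
    have := one_sub_tVal_pos hd (node_pos (n := n) hn hd (show k ≤ 2 * n - 1 by omega) hk1)
    calc (0 : ℝ) < ((2 ^ d - 2) * (1 - tVal d (node n d k))) *
          ((-1) ^ (k / 2) * chebU d (n - 1) (node n d k)) :=
          mul_pos (mul_pos (by linarith) this) ha
      _ = _ := by ring

theorem zeroFactor_node_even {n d k : ℕ} (hn : 2 ≤ n) (hd : 2 ≤ d) (hk : k ≤ 2 * n - 2)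
    (hk1 : 1 ≤ k) (he : Even k) : (-1) ^ (k / 2) * zeroFactor n d (node n d k) < 0 := by
  have h4 := four_le_two_pow hd
  have ha := (node_sin hn hd hk hk1).2
  rw [zeroFactor_of_sumFactor n d _ (sumFactor_node hn hd hk hk1 he).1]
  have := one_sub_tVal_pos hd (node_pos (n := n) hn hd (show k ≤ 2 * n - 1 by omega) hk1)
  have h := mul_pos (mul_pos (show (0 : ℝ) < 2 ^ d - 2 by linarith) this) ha
  linarith

theorem zeroFactor_node_odd {n d k : ℕ} (hn : 2 ≤ n) (hd : 2 ≤ d) (hk : k ≤ 2 * n - 2)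
    (ho : Odd k) : 0 < (-1) ^ (k / 2) * zeroFactor n d (node n d k) := by
  have h4 := four_le_two_pow hd
  have ha := (node_sin hn hd hk ho.pos).2
  have h := decimation_zero n d (node n d k)
  rw [decimation_node_odd hn hd hk ho, (diffFactor_node hn hd hk ho).2, mul_topValue hd] at h
  set a := chebU d (n - 1) (node n d k)
  set q := zeroFactor n d (node n d k)
  have hsq : ((-1 : ℝ) ^ (k / 2)) * (-1) ^ (k / 2) = 1 := by rw [← mul_pow]; norm_num
  set s := (-1 : ℝ) ^ (k / 2)
  have : (s * a) * (s * q) = 2 ^ d / 2 := by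
    linear_combination a * q * hsq - h / 2
  exact (mul_pos_iff_of_pos_left ha).1 (by rw [this]; positivity)

theorem exists_zero_of_signs {g : ℝ → ℝ} (hg : Continuous g) {x y : ℝ} (hxy : x < y)
    {s : ℝ} (h : 0 < s * g x ∧ s * g y < 0 ∨ s * g x < 0 ∧ 0 < s * g y) :
    ∃ r ∈ Set.Ioo x y, g r = 0 := by
  have hc : ContinuousOn (fun r => s * g r) (Set.Icc x y) := (hg.const_mul s).continuousOn
  have hs : s ≠ 0 := by rintro rfl; simp at h
  rcases h with h | h
  · obtain ⟨r, hr, e⟩ := intermediate_value_Ioo' hxy.le hc ⟨h.2, h.1⟩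
    exact ⟨r, hr, (mul_eq_zero.1 e).resolve_left hs⟩
  · obtain ⟨r, hr, e⟩ := intermediate_value_Ioo hxy.le hc ⟨h.1, h.2⟩
    exact ⟨r, hr, (mul_eq_zero.1 e).resolve_left hs⟩

theorem topFactor_one_sign {n d : ℕ} (hn : 2 ≤ n) (hd : 2 ≤ d) :
    (-1) ^ (n - 1) * topFactor n d 1 < 0 := by
  have h4 := four_le_two_pow hd
  obtain ⟨h1, -, h3⟩ := signs_at_one hn hd
  have h := decimation_top n d 1
  have h5 := mul_topValue hd
  have h6 : (2 : ℝ) ^ d < (2 ^ d - 1) * (decimation n d).eval 1 := by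
    exact h5.symm.trans_lt (mul_lt_mul_of_pos_left h1 (by linarith))
  have hsq : ((-1 : ℝ) ^ (n - 1)) * (-1) ^ (n - 1) = 1 := by rw [← mul_pow]; norm_num
  set s := (-1 : ℝ) ^ (n - 1)
  have : (s * diffFactor n d 1) * (s * topFactor n d 1) < 0 := by
    have : (s * diffFactor n d 1) * (s * topFactor n d 1)
      = diffFactor n d 1 * topFactor n d 1 := by
        linear_combination diffFactor n d 1 * topFactor n d 1 * hsq
    linarith
  exact neg_of_mul_neg_right this h3.le

theorem zeroFactor_one_sign {n d : ℕ} (hn : 2 ≤ n) (hd : 2 ≤ d) :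
    0 < (-1) ^ (n - 1) * zeroFactor n d 1 := by
  have h4 := four_le_two_pow hd
  obtain ⟨h1, h2, -⟩ := signs_at_one hn hd
  have h := decimation_zero n d 1
  have h5 := one_lt_topValue hd
  have h6 : (0 : ℝ) < (2 ^ d - 1) * (decimation n d).eval 1 :=
    mul_pos (by linarith) (by linarith)
  have hsq : ((-1 : ℝ) ^ (n - 1)) * (-1) ^ (n - 1) = 1 := by rw [← mul_pow]; norm_num
  set s := (-1 : ℝ) ^ (n - 1)
  have : 0 < (s * sumFactor n d 1) * (s * zeroFactor n d 1) := by
    have : (s * sumFactor n d 1) * (s * zeroFactor n d 1)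
      = sumFactor n d 1 * zeroFactor n d 1 := by
        linear_combination sumFactor n d 1 * zeroFactor n d 1 * hsq
    linarith
  exact (mul_pos_iff_of_pos_left h2).1 this

/-- Supplies the preimage of the top value in the intervals whose right end point is not an odd
node. -/
theorem exists_topFactor_zero {n d l : ℕ} (hn : 2 ≤ n) (hd : 2 ≤ d) (hl : l < 2 * n - 1)
    (h : Odd l ∨ l = 2 * n - 2) :
    ∃ r ∈ Set.Ioo (node n d l) (node n d (l + 1)), topFactor n d r = 0 := by
  apply exists_zero_of_signs (continuous_topFactor n d) (node_lt_succ hn hd hl)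
    (s := (-1) ^ (l / 2))
  left
  by_cases hl' : l = 2 * n - 2
  · refine ⟨topFactor_node_sign hn hd (by omega) (by omega), ?_⟩
    rw [show l + 1 = 2 * n - 1 by omega, node_last hn, show l / 2 = n - 1 by omega]
    exact topFactor_one_sign hn hd
  · obtain ⟨j, rfl⟩ := h.resolve_right hl'
    refine ⟨topFactor_node_sign hn hd (by omega) (by omega), ?_⟩
    have := topFactor_node_sign (k := 2 * j + 1 + 1) hn hd (by omega) (by omega)
    rw [show (2 * j + 1 + 1) / 2 = j + 1 by omega, pow_succ] at this
    rw [show (2 * j + 1) / 2 = j by omega]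
    linarith

theorem exists_zeroFactor_zero {n d l : ℕ} (hn : 2 ≤ n) (hd : 2 ≤ d) (hl : l < 2 * n - 1)
    (h : Even l) (h2 : 2 ≤ l) :
    ∃ r ∈ Set.Ioo (node n d l) (node n d (l + 1)), zeroFactor n d r = 0 := by
  apply exists_zero_of_signs (continuous_zeroFactor n d) (node_lt_succ hn hd hl)
    (s := (-1) ^ (l / 2))
  right
  refine ⟨zeroFactor_node_even hn hd (by omega) (by omega) h, ?_⟩
  obtain ⟨j, rfl⟩ := h.two_dvd
  by_cases hl' : 2 * j = 2 * n - 2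
  · rw [show 2 * j + 1 = 2 * n - 1 by omega, node_last hn, show (2 * j) / 2 = n - 1 by omega]
    exact zeroFactor_one_sign hn hd
  · have := zeroFactor_node_odd (k := 2 * j + 1) hn hd (by omega) (odd_two_mul_add_one j)
    rwa [show (2 * j + 1) / 2 = 2 * j / 2 by omega] at this

/-! ### Localization of the inverse branches. -/

/-- The `l`-th interval of localization: `x` lies in `(node l, node (l+1)]`, or in the closed
interval for `l = 0`. -/
def InBranch (n d l : ℕ) (x : ℝ) : Prop :=
  node n d l ≤ x ∧ x ≤ node n d (l + 1) ∧ (l ≠ 0 → node n d l < x)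

theorem inBranch_of_mem_Ioo {n d l : ℕ} {x : ℝ}
    (h : x ∈ Set.Ioo (node n d l) (node n d (l + 1))) : InBranch n d l x :=
  ⟨h.1.le, h.2.le, fun _ => h.1⟩

theorem inBranch_node_succ {n d l : ℕ} (hn : 2 ≤ n) (hd : 2 ≤ d) (hl : l < 2 * n - 1) :
    InBranch n d l (node n d (l + 1)) :=
  ⟨(node_lt_succ hn hd hl).le, le_rfl, fun _ => node_lt_succ hn hd hl⟩

theorem inBranch_zero {n d : ℕ} (hn : 2 ≤ n) (hd : 2 ≤ d) : InBranch n d 0 0 :=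
  ⟨(node_zero n d).le, (node_pos hn hd (by omega) (by omega)).le, fun h => absurd rfl h⟩

theorem InBranch.lt {n d k l : ℕ} {x y : ℝ} (hn : 2 ≤ n) (hd : 2 ≤ d) (hl : l < 2 * n - 1)
    (hx : InBranch n d k x) (hy : InBranch n d l y) (hkl : k < l) : x < y :=
  (hx.2.1.trans (node_monotone hn hd hkl (by omega))).trans_lt (hy.2.2 (by omega))

theorem InBranch.mem_Icc {n d l : ℕ} {x : ℝ} (hn : 2 ≤ n) (hd : 2 ≤ d) (hl : l < 2 * n - 1)
    (hx : InBranch n d l x) : x ∈ Set.Icc (0 : ℝ) 1 := by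
  constructor
  · rw [← node_zero n d]
    exact (node_monotone hn hd (Nat.zero_le l) hl.le).trans hx.1
  · rw [← node_last (d := d) hn]
    exact hx.2.1.trans (node_monotone hn hd hl le_rfl)

/-- For `y` strictly between the extremes, `R` crosses `y` inside every interval. At the two
extremes a solution may sit on a node; it is then charged to the interval on its left, and the
interval on its right receives its own solution from a sign change of `zeroFactor` or `topFactor`.
-/
theorem exists_inBranch {n d l : ℕ} (hn : 2 ≤ n) (hd : 2 ≤ d) (hl : l < 2 * n - 1) {y : ℝ}
    (hy : y ∈ Set.Icc 0 (topValue d)) : ∃ r, InBranch n d l r ∧ (decimation n d).eval r = y := by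
  have h1 := one_lt_topValue hd
  have hc : ContinuousOn (fun r => (decimation n d).eval r)
      (Set.Icc (node n d l) (node n d (l + 1))) := (Polynomial.continuous _).continuousOn
  have hlt := node_lt_succ (d := d) hn hd hl
  rcases hy.1.eq_or_lt with rfl | hy0
  · rcases Nat.even_or_odd l with he | ho
    · rcases Nat.eq_zero_or_pos l with rfl | hpos
      · exact ⟨0, inBranch_zero hn hd, decimation_eval_zero n d⟩
      · obtain ⟨r, hr, e⟩ := exists_zeroFactor_zero (d := d) hn hd hl he
          (by obtain ⟨j, rfl⟩ := he; omega)
        exact ⟨r, inBranch_of_mem_Ioo hr, (decimation_eq_zero_iff hd n r).2 (Or.inr e)⟩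
    · refine ⟨_, inBranch_node_succ hn hd hl, decimation_node_even hn hd ?_ ho.add_one⟩
      obtain ⟨j, rfl⟩ := ho; omega
  rcases hy.2.eq_or_lt with rfl | hy1
  · by_cases h : Odd l ∨ l = 2 * n - 2
    · obtain ⟨r, hr, e⟩ := exists_topFactor_zero (d := d) hn hd hl h
      exact ⟨r, inBranch_of_mem_Ioo hr, (decimation_eq_topValue_iff hd n r).2 (Or.inr e)⟩
    · push Not at h
      refine ⟨_, inBranch_node_succ hn hd hl, decimation_node_odd hn hd (by omega) ?_⟩
      exact (Nat.not_odd_iff_even.1 h.1).add_one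
  rcases Nat.even_or_odd l with he | ho
  · have e0 := decimation_node_even (d := d) hn hd (by omega : l ≤ 2 * n - 2) he
    have e1 : topValue d ≤ (decimation n d).eval (node n d (l + 1)) := by
      by_cases h : l + 1 ≤ 2 * n - 2
      · rw [decimation_node_odd hn hd h he.add_one]
      · rw [show l + 1 = 2 * n - 1 by omega, node_last hn]
        exact (signs_at_one hn hd).1.le
    obtain ⟨r, hr, e⟩ := intermediate_value_Ioo hlt.le hc
      (show y ∈ Set.Ioo _ _ from ⟨by simp only [e0]; exact hy0, hy1.trans_le e1⟩)
    exact ⟨r, inBranch_of_mem_Ioo hr, e⟩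
  · have e0 := decimation_node_odd (d := d) hn hd (by omega : l ≤ 2 * n - 2) ho
    have e1 := decimation_node_even (d := d) (k := l + 1) hn hd
      (by obtain ⟨j, rfl⟩ := ho; omega) ho.add_one
    obtain ⟨r, hr, e⟩ := intermediate_value_Ioo' hlt.le hc
      (show y ∈ Set.Ioo _ _ from ⟨by simp only [e1]; exact hy0, by simp only [e0]; exact hy1⟩)
    exact ⟨r, inBranch_of_mem_Ioo hr, e⟩

theorem decimation_sub_C_ne_zero {n d : ℕ} (hn : 2 ≤ n) (hd : 2 ≤ d) (y : ℝ) :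
    decimation n d - C y ≠ 0 := by
  intro h
  have h0 : (decimation n d - C y).eval 0 = 0 := by rw [h]; simp
  have h1 : (decimation n d - C y).eval 1 = 0 := by rw [h]; simp
  rw [eval_sub, eval_C, decimation_eval_zero] at h0
  rw [eval_sub, eval_C] at h1
  have := (signs_at_one hn hd).1
  have := one_lt_topValue hd
  linarith

theorem strictMono_of_inBranch {n d : ℕ} (hn : 2 ≤ n) (hd : 2 ≤ d) {r : Fin (2 * n - 1) → ℝ}
    (hr : ∀ l : Fin (2 * n - 1), InBranch n d l (r l)) : StrictMono r :=
  fun k l hkl => (hr k).lt hn hd l.2 (hr l) hkl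

/-- One solution in each interval already exhausts the degree, so these are all the roots, and the
increasing enumeration of a finite set is unique. -/
theorem branch_eq_of_inBranch_aux {n d : ℕ} (hn : 2 ≤ n) (hd : 2 ≤ d) {y : ℝ}
    {r : Fin (2 * n - 1) → ℝ} (hr : ∀ l : Fin (2 * n - 1), InBranch n d l (r l))
    (he : ∀ l, (decimation n d).eval (r l) = y) :
    (∀ l : Fin (2 * n - 1), branch n d l y = r l) ∧
      Set.range r = {x | (decimation n d).eval x = y} := by
  have hne := decimation_sub_C_ne_zero hn hd y
  have hmono := strictMono_of_inBranch hn hd hr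
  set s := (decimation n d - C y).roots.toFinset with hs
  have hmem (x : ℝ) : x ∈ s ↔ (decimation n d).eval x = y := by
    rw [hs, Multiset.mem_toFinset, mem_roots hne, IsRoot.def, eval_sub, eval_C, sub_eq_zero]
  have hsub : Finset.univ.image r ⊆ s := by
    intro x hx
    obtain ⟨l, -, rfl⟩ := Finset.mem_image.1 hx
    exact (hmem _).2 (he l)
  have hcard : s.card ≤ 2 * n - 1 := by
    refine (Multiset.toFinset_card_le _).trans ((card_roots' _).trans ?_)
    rw [natDegree_sub_C]
    exact natDegree_decimation_le hn
  have himg : (Finset.univ.image r).card = 2 * n - 1 := by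
    rw [Finset.card_image_of_injective _ hmono.injective, Finset.card_univ, Fintype.card_fin]
  have heq : Finset.univ.image r = s := Finset.eq_of_subset_of_card_le hsub (by omega)
  have hcard' : s.card = 2 * n - 1 := by rw [← heq, himg]
  constructor
  · intro l
    have h := Finset.orderEmbOfFin_unique hcard' (fun l => (hmem (r l)).2 (he l)) hmono
    rw [h, Finset.orderEmbOfFin_apply, branch]
    rw [List.getD_eq_getElem]
    rfl
  · ext x
    rw [Set.mem_ofPred_eq, ← hmem, ← heq]
    simp

/-- The solutions of `R(x) = y` are the values of the inverse branches, separated by the nodes. -/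
theorem branch_spec {n d : ℕ} (hn : 2 ≤ n) (hd : 2 ≤ d) {y : ℝ} (hy : y ∈ Set.Icc 0 (topValue d)) :
    (∀ l : Fin (2 * n - 1), InBranch n d l (branch n d l y)) ∧
      Set.range (fun l : Fin (2 * n - 1) => branch n d l y) =
        {x | (decimation n d).eval x = y} := by
  choose r hr he using fun l : Fin (2 * n - 1) => exists_inBranch hn hd l.2 hy
  obtain ⟨h1, h2⟩ := branch_eq_of_inBranch_aux hn hd hr he
  simp only [h1]
  exact ⟨hr, h2⟩

theorem decimation_branch {n d : ℕ} (hn : 2 ≤ n) (hd : 2 ≤ d) {y : ℝ}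
    (hy : y ∈ Set.Icc 0 (topValue d)) (l : Fin (2 * n - 1)) :
    (decimation n d).eval (branch n d l y) = y := by
  have := (branch_spec hn hd hy).2
  have h : branch n d l y ∈ {x | (decimation n d).eval x = y} := by
    rw [← this]; exact ⟨l, rfl⟩
  exact h

theorem branch_strictMono {n d : ℕ} (hn : 2 ≤ n) (hd : 2 ≤ d) {y : ℝ}
    (hy : y ∈ Set.Icc 0 (topValue d)) : StrictMono (fun l : Fin (2 * n - 1) => branch n d l y) :=
  strictMono_of_inBranch hn hd (branch_spec hn hd hy).1

theorem branch_mem_Icc {n d : ℕ} (hn : 2 ≤ n) (hd : 2 ≤ d) {y : ℝ}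
    (hy : y ∈ Set.Icc 0 (topValue d)) (l : Fin (2 * n - 1)) :
    branch n d l y ∈ Set.Icc (0 : ℝ) 1 :=
  ((branch_spec hn hd hy).1 l).mem_Icc hn hd l.2

theorem branch_eq {n d : ℕ} (hn : 2 ≤ n) (hd : 2 ≤ d) {x : ℝ} {l : Fin (2 * n - 1)}
    (hx : InBranch n d l x) {y : ℝ} (hxy : (decimation n d).eval x = y)
    (hy : y ∈ Set.Icc 0 (topValue d)) : branch n d l y = x := by
  obtain ⟨h1, h2⟩ := branch_spec hn hd hy
  have : x ∈ Set.range (fun l : Fin (2 * n - 1) => branch n d l y) := by rw [h2]; exact hxy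
  obtain ⟨k, rfl⟩ := this
  rcases lt_trichotomy l k with h | h | h
  · exact absurd (hx.lt hn hd k.2 (h1 k) h) (lt_irrefl _)
  · rw [h]
  · exact absurd ((h1 k).lt hn hd l.2 hx h) (lt_irrefl _)

theorem zero_mem_Icc_top {d : ℕ} (hd : 2 ≤ d) : (0 : ℝ) ∈ Set.Icc 0 (topValue d) :=
  ⟨le_rfl, by linarith [one_lt_topValue hd]⟩

theorem top_mem_Icc_top {d : ℕ} (hd : 2 ≤ d) : topValue d ∈ Set.Icc 0 (topValue d) :=
  ⟨by linarith [one_lt_topValue hd], le_rfl⟩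

theorem branch_zero_zero {n d : ℕ} (hn : 2 ≤ n) (hd : 2 ≤ d) : branch n d 0 0 = 0 :=
  branch_eq hn hd (l := ⟨0, by omega⟩) (inBranch_zero hn hd) (decimation_eval_zero n d)
    (zero_mem_Icc_top hd)

/-- The decimation is regular at the interior preimages of `y ∈ (0, top)`. -/
theorem regular_branch_of_mem_Ioo {n d : ℕ} (hn : 2 ≤ n) (hd : 2 ≤ d) {y : ℝ}
    (hy : y ∈ Set.Ioo 0 (topValue d)) (l : Fin (2 * n - 1)) :
    sumFactor n d (branch n d l y) ≠ 0 ∧ topFactor n d (branch n d l y) ≠ 0 := by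
  have h := decimation_branch hn hd ⟨hy.1.le, hy.2.le⟩ l
  constructor
  · intro e
    rw [(decimation_eq_zero_iff hd n _).2 (Or.inl e)] at h
    exact hy.1.ne h
  · intro e
    rw [(decimation_eq_topValue_iff hd n _).2 (Or.inr e)] at h
    exact hy.2.ne h.symm

/-- Here the preimage is an odd node, a zero of `diffFactor`. The remaining letters lead to zeros of
`topFactor`, hence their exclusion. -/
theorem regular_branch_top {n d : ℕ} (hn : 2 ≤ n) (hd : 2 ≤ d) (l : Fin (2 * n - 1))
    (he : Even (l : ℕ)) (hl : (l : ℕ) ≤ 2 * n - 4) :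
    sumFactor n d (branch n d l (topValue d)) ≠ 0 ∧
      topFactor n d (branch n d l (topValue d)) ≠ 0 := by
  have hb : branch n d l (topValue d) = node n d (l + 1) :=
    branch_eq hn hd (inBranch_node_succ hn hd l.2)
      (decimation_node_odd hn hd (by omega) he.add_one) (top_mem_Icc_top hd)
  rw [hb]
  exact regular_of_diffFactor hd (node_pos hn hd (by omega) (by omega)).ne'
    (diffFactor_node hn hd (by omega) he.add_one).1

/-- Odd letters would lead from `0` to even nodes, where `sumFactor` vanishes, and the letter `0`
back to `0`. The letters kept give zeros of `zeroFactor`. -/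
theorem regular_branch_zero {n d : ℕ} (hn : 2 ≤ n) (hd : 2 ≤ d) (l : Fin (2 * n - 1))
    (he : Even (l : ℕ)) (hl : 2 ≤ (l : ℕ)) :
    sumFactor n d (branch n d l 0) ≠ 0 ∧ topFactor n d (branch n d l 0) ≠ 0 := by
  obtain ⟨r, hr, hz⟩ := exists_zeroFactor_zero (d := d) hn hd l.2 he hl
  have h0 := (decimation_eq_zero_iff hd n r).2 (Or.inr hz)
  rw [branch_eq hn hd (inBranch_of_mem_Ioo hr) h0 (zero_mem_Icc_top hd)]
  have hpos : 0 < r := (node_pos hn hd (by omega) (by omega)).trans hr.1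
  refine ⟨sumFactor_ne_zero_of_zeroFactor hd hpos.ne' hz, fun e => ?_⟩
  rw [(decimation_eq_topValue_iff hd n r).2 (Or.inr e)] at h0
  linarith [one_lt_topValue hd]

end

/-! ### Admissible words and the values they reach. -/

theorem branchWord_concat (n d : ℕ) (u : List (Fin (2 * n - 1))) (l : Fin (2 * n - 1)) (y : ℝ) :
    branchWord n d (u ++ [l]) y = branch n d l (branchWord n d u y) := by
  simp [branchWord, List.foldl_append]

theorem branchWord_mem {n d : ℕ} (hn : 2 ≤ n) (hd : 2 ≤ d) (u : List (Fin (2 * n - 1))) {y : ℝ}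
    (hy : y ∈ Set.Icc 0 (topValue d)) : branchWord n d u y ∈ Set.Icc 0 (topValue d) := by
  induction u generalizing y with
  | nil => exact hy
  | cons a u ih =>
    exact ih ⟨(branch_mem_Icc hn hd hy a).1,
      (branch_mem_Icc hn hd hy a).2.trans (one_lt_topValue hd).le⟩

theorem branchWord_concat_mem {n d : ℕ} (hn : 2 ≤ n) (hd : 2 ≤ d) (u : List (Fin (2 * n - 1)))
    (l : Fin (2 * n - 1)) {y : ℝ} (hy : y ∈ Set.Icc 0 (topValue d)) :
    branchWord n d (u ++ [l]) y ∈ Set.Icc (0 : ℝ) 1 := by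
  rw [branchWord_concat]
  exact branch_mem_Icc hn hd (branchWord_mem hn hd u hy) l

/-- `R` fixes `0` and inverts each branch, so every intermediate value is `0` too; strict
monotonicity then singles out the letter `0`. -/
theorem branchWord_eq_zero {n d : ℕ} (hn : 2 ≤ n) (hd : 2 ≤ d) (u : List (Fin (2 * n - 1)))
    {y : ℝ} (hy : y ∈ Set.Icc 0 (topValue d)) (h : branchWord n d u y = 0) :
    y = 0 ∧ ∀ a ∈ u.head?, (a : ℕ) = 0 := by
  induction u generalizing y with
  | nil => exact ⟨h, by simp⟩
  | cons a u ih =>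
    have hb := branch_mem_Icc hn hd hy a
    obtain ⟨h0, -⟩ := ih ⟨hb.1, hb.2.trans (one_lt_topValue hd).le⟩ h
    have hy0 : y = 0 := by
      rw [← decimation_branch hn hd hy a, h0, decimation_eval_zero]
    refine ⟨hy0, ?_⟩
    subst hy0
    have := (branch_strictMono hn hd hy).injective (a₁ := a) (a₂ := ⟨0, by omega⟩)
      (h0.trans (branch_zero_zero hn hd).symm)
    simp [this]

/-- The two initial values: `2^d / (2^d - 1)` and `0`. -/
def seed (d : ℕ) : Bool → ℝ
  | true => topValue d
  | false => 0

/-- The words admitted after each of the two initial values. -/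
def admissible (n : ℕ) : Bool → Set (List (Fin (2 * n - 1)))
  | true => firstKind n
  | false => secondKind n

theorem seed_mem {d : ℕ} (hd : 2 ≤ d) (s : Bool) : seed d s ∈ Set.Icc 0 (topValue d) := by
  cases s
  · exact zero_mem_Icc_top hd
  · exact top_mem_Icc_top hd

theorem nil_admissible (n : ℕ) (s : Bool) : [] ∈ admissible n s := by
  cases s <;> simp [admissible, firstKind, secondKind]

theorem admissible_of_concat {n : ℕ} {s : Bool} {u : List (Fin (2 * n - 1))} {l : Fin (2 * n - 1)}
    (h : u ++ [l] ∈ admissible n s) : u ∈ admissible n s := by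
  cases u with
  | nil => exact nil_admissible n s
  | cons a u => cases s <;> simpa [admissible, firstKind, secondKind] using h

theorem branchWord_ne_zero {n d : ℕ} (hn : 2 ≤ n) (hd : 2 ≤ d) {s : Bool}
    {u : List (Fin (2 * n - 1))} (h : u ∈ admissible n s) (hu : u ≠ []) :
    branchWord n d u (seed d s) ≠ 0 := by
  intro e
  obtain ⟨h1, h2⟩ := branchWord_eq_zero hn hd u (seed_mem hd s) e
  cases s with
  | true => linarith [one_lt_topValue hd, show topValue d = 0 from h1]
  | false =>
    obtain ⟨a, u, rfl⟩ := List.exists_cons_of_ne_nil hu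
    have h3 := h a (by simp)
    have h4 := h2 a (by simp)
    omega

theorem branchWord_ne_seed {n d : ℕ} (hn : 2 ≤ n) (hd : 2 ≤ d) {s s' : Bool}
    {u : List (Fin (2 * n - 1))} (h : u ∈ admissible n s) (hu : u ≠ []) :
    branchWord n d u (seed d s) ≠ seed d s' := by
  cases s' with
  | false => exact branchWord_ne_zero hn hd h hu
  | true =>
    obtain ⟨w, l, rfl⟩ := List.eq_nil_or_concat' u |>.resolve_left hu
    have := (branchWord_concat_mem hn hd w l (seed_mem hd s)).2
    have := one_lt_topValue hd
    exact (by linarith : _ < topValue d).ne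

/-- Applying `R` removes the last letter, and monotonicity of the branches recovers it. The descent
stops correctly because nonempty admissible words take values in `(0, 1]`, away from both seeds. -/
theorem branchWord_injective {n d : ℕ} (hn : 2 ≤ n) (hd : 2 ≤ d) {s s' : Bool}
    (v w : List (Fin (2 * n - 1))) (hv : v ∈ admissible n s) (hw : w ∈ admissible n s')
    (h : branchWord n d v (seed d s) = branchWord n d w (seed d s')) : s = s' ∧ v = w := by
  induction v using List.reverseRecOn generalizing w with
  | nil =>
    by_cases hw0 : w = []
    · subst hw0
      have h1 := one_lt_topValue hd
      refine ⟨?_, rfl⟩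
      cases s <;> cases s' <;> simp [branchWord, seed] at h ⊢ <;> linarith
    · exact absurd h.symm (branchWord_ne_seed hn hd hw hw0)
  | append_singleton u l ih =>
    by_cases hw0 : w = []
    · subst hw0
      exact absurd h (branchWord_ne_seed hn hd hv (by simp))
    · obtain ⟨w, l', rfl⟩ := List.eq_nil_or_concat' w |>.resolve_left hw0
      rw [branchWord_concat, branchWord_concat] at h
      have hY := branchWord_mem hn hd u (seed_mem hd s)
      have hZ := branchWord_mem hn hd w (seed_mem hd s')
      have hYZ : branchWord n d u (seed d s) = branchWord n d w (seed d s') := by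
        rw [← decimation_branch hn hd hY l, h, decimation_branch hn hd hZ l']
      obtain ⟨rfl, rfl⟩ := ih w (admissible_of_concat hv) (admissible_of_concat hw) hYZ
      exact ⟨rfl, by rw [(branch_strictMono hn hd hY).injective h]⟩

theorem regular_of_admissible {n d : ℕ} (hn : 2 ≤ n) (hd : 2 ≤ d) {s : Bool}
    {u : List (Fin (2 * n - 1))} {l : Fin (2 * n - 1)} (h : u ++ [l] ∈ admissible n s) :
    sumFactor n d (branchWord n d (u ++ [l]) (seed d s)) ≠ 0 ∧
      topFactor n d (branchWord n d (u ++ [l]) (seed d s)) ≠ 0 := by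
  rw [branchWord_concat]
  by_cases hu : u = []
  · subst hu
    cases s with
    | true =>
      obtain ⟨h1, h2⟩ := h l (by simp)
      exact regular_branch_top hn hd l h1 h2
    | false =>
      obtain ⟨h1, h2⟩ := h l (by simp)
      exact regular_branch_zero hn hd l h1 h2
  · have hm := branchWord_mem hn hd u (seed_mem hd s)
    have hu' := admissible_of_concat h
    exact regular_branch_of_mem_Ioo hn hd
      ⟨lt_of_le_of_ne hm.1 (branchWord_ne_seed (s' := false) hn hd hu' hu).symm,
        lt_of_le_of_ne hm.2 (branchWord_ne_seed (s' := true) hn hd hu' hu)⟩ l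

/-! ### Counting admissible words with their predicted multiplicities. -/

/-- An index type for the admissible words of length at most `m`. -/
abbrev WordIndex (n m : ℕ) : Type :=
  Option (Σ k : Fin m, Fin (n - 1) × (Fin (k : ℕ) → Fin (2 * n - 1)))

/-- The first letter of the admissible word with a given index. -/
def firstLetter (n : ℕ) (s : Bool) (j : Fin (n - 1)) : Fin (2 * n - 1) :=
  ⟨2 * j + (if s then 0 else 2), by split <;> omega⟩

/-- The admissible word with a given index. -/
def indexWord (n m : ℕ) (s : Bool) : WordIndex n m → List (Fin (2 * n - 1))
  | none => []
  | some ⟨_, j, g⟩ => firstLetter n s j :: List.ofFn g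

theorem indexWord_admissible {n m : ℕ} (s : Bool) (i : WordIndex n m) :
    indexWord n m s i ∈ admissible n s := by
  match i with
  | none => exact nil_admissible n s
  | some ⟨k, j, g⟩ =>
    cases s <;> simp only [indexWord, admissible, firstKind, secondKind, Set.mem_ofPred_eq,
      List.head?_cons, Option.mem_def, Option.some.injEq, forall_eq', firstLetter]
    · exact ⟨by simp [parity_simps], by simp⟩
    · exact ⟨by simp, by simp; omega⟩

theorem indexWord_length_le {n m : ℕ} (s : Bool) (i : WordIndex n m) :
    (indexWord n m s i).length ≤ m := by
  match i with
  | none => simp [indexWord]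
  | some ⟨k, j, g⟩ => simp [indexWord]

theorem indexWord_surjective {n m : ℕ} (hn : 2 ≤ n) (s : Bool) (v : List (Fin (2 * n - 1)))
    (hv : v ∈ admissible n s) (hm : v.length ≤ m) : ∃ i, indexWord n m s i = v := by
  cases v with
  | nil => exact ⟨none, rfl⟩
  | cons a u =>
    have : ∃ j, firstLetter n s j = a := by
      cases s with
      | true =>
        obtain ⟨h1, h2⟩ := hv a (by simp)
        obtain ⟨j, hj⟩ := h1
        exact ⟨⟨j, by omega⟩, by ext; simp [firstLetter]; omega⟩
      | false =>
        obtain ⟨h1, h2⟩ := hv a (by simp)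
        obtain ⟨j, hj⟩ := h1
        exact ⟨⟨j - 1, by omega⟩, by ext; simp [firstLetter]; omega⟩
    obtain ⟨j, rfl⟩ := this
    refine ⟨some ⟨⟨u.length, by simpa using hm⟩, j, u.get⟩, ?_⟩
    simp [indexWord]

theorem indexWord_injective (n m : ℕ) (s : Bool) : Function.Injective (indexWord n m s) := by
  intro i i' h
  match i, i' with
  | none, none => rfl
  | none, some ⟨k, j, g⟩ => simp [indexWord] at h
  | some ⟨k, j, g⟩, none => simp [indexWord] at h
  | some ⟨k, j, g⟩, some ⟨k', j', g'⟩ =>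
    simp only [indexWord, List.cons.injEq] at h
    obtain ⟨h1, h2⟩ := h
    have hk : k = k' := by
      have := congrArg List.length h2
      simp only [List.length_ofFn] at this
      exact Fin.ext this
    subst hk
    have hg := List.ofFn_injective h2
    have hj : j = j' := by
      simp only [firstLetter, Fin.mk.injEq] at h1
      ext; omega
    rw [hg, hj]

theorem sum_wordIndex (n m : ℕ) (s : Bool) (F : ℕ → ℕ) :
    ∑ i : WordIndex n m, F (indexWord n m s i).length =
      F 0 + ∑ k ∈ Finset.range m, (n - 1) * (2 * n - 1) ^ k * F (k + 1) := by
  rw [Fintype.sum_option, Fintype.sum_sigma, Finset.sum_range]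
  simp [indexWord]

/-- The predicted multiplicities add up to the number of vertices. -/
theorem sum_multiplicities {n d : ℕ} (hn : 2 ≤ n) (hd : 2 ≤ d) (m : ℕ) :
    ∑ i : WordIndex n m, ((2 ^ d * n - 2 ^ d + 1) ^ (m - (indexWord n m true i).length)
        * (2 ^ d - 2) + 1) + ∑ _i : WordIndex n m, 1 =
      (2 ^ d * n - 2 ^ d + 1) ^ m * (2 ^ d - 1) + 1 := by
  rw [sum_wordIndex n m true fun l => (2 ^ d * n - 2 ^ d + 1) ^ (m - l) * (2 ^ d - 2) + 1,
    sum_wordIndex n m true fun _ => 1]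
  obtain ⟨p, rfl⟩ : ∃ p, n = p + 1 := ⟨n - 1, by omega⟩
  have h4 : 4 ≤ 2 ^ d := by
    calc 4 = 2 ^ 2 := by norm_num
      _ ≤ 2 ^ d := Nat.pow_le_pow_right (by norm_num) hd
  obtain ⟨M, hM⟩ : ∃ M, 2 ^ d = M + 2 := ⟨2 ^ d - 2, by omega⟩
  rw [hM]
  have e1 : (M + 2) * (p + 1) - (M + 2) + 1 = (M + 2) * p + 1 := by
    rw [Nat.mul_succ]; simp
  have e2 : 2 * (p + 1) - 1 = 2 * p + 1 := by omega
  rw [e1, e2]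
  simp only [Nat.add_sub_cancel, Nat.sub_zero, show M + 2 - 1 = M + 1 from rfl]
  set c := (M + 2) * p + 1 with hc
  set q := 2 * p + 1 with hq
  zify
  -- Since `q - c = -pM` and `q - 1 = 2p`, the mixed geometric sum contributes `c^m - q^m` and the
  -- two plain ones together contribute `q^m - 1`; the powers of `q` cancel.
  have g1 := geom_sum₂_mul (R := ℤ) q c m
  have g2 := geom_sum_mul (R := ℤ) q m
  have s1 : ∑ k ∈ Finset.range m, ((p : ℤ) * q ^ k * (c ^ (m - (k + 1)) * M + 1)) =
      (∑ k ∈ Finset.range m, (q : ℤ) ^ k * c ^ (m - 1 - k)) * (p * M)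
        + (∑ k ∈ Finset.range m, (q : ℤ) ^ k) * p := by
    rw [Finset.sum_mul, Finset.sum_mul, ← Finset.sum_add_distrib]
    refine Finset.sum_congr rfl fun k _ => ?_
    rw [show m - (k + 1) = m - 1 - k by omega]
    ring
  have s2 : ∑ k ∈ Finset.range m, ((p : ℤ) * q ^ k * 1) = (∑ k ∈ Finset.range m, (q : ℤ) ^ k) * p := by
    rw [Finset.sum_mul]
    exact Finset.sum_congr rfl fun k _ => by ring
  rw [s1, s2]
  have hqc : (q : ℤ) - c = -(p * M) := by rw [hq, hc]; push_cast; ring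
  have hq1 : (q : ℤ) - 1 = 2 * p := by rw [hq]; push_cast; ring
  rw [hqc] at g1
  rw [hq1] at g2
  linear_combination -g1 + g2

/-! ### Geometry of the cells of level one. -/

/-- Addresses of the cells of level one: `none` is the central cell, and `some (i, r)` is the cell
on the arm towards the corner `i`, at distance `r + 1` from the centre. -/
abbrev Letter (n d : ℕ) : Type := Option ((Fin d → Fin 2) × Fin (n - 1))

/-- The contraction onto the cell with address `a`. -/
def letterMap (n d : ℕ) : Letter n d → (Fin d → ℝ) → (Fin d → ℝ)
  | none => contraction n 0 n
  | some (i, r) => contraction n i (n - 1 - r)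

/-- The position of the cell with address `a` in the grid of mesh `1/(2n-1)`. -/
def offset (n d : ℕ) : Letter n d → Fin d → ℤ
  | none, _ => n - 1
  | some (i, r), k => n - 1 + (2 * (i k : ℕ) - 1) * (r + 1)

/-- After scaling by `2n-1` the cells are unit cubes at integer positions, so all questions of
contact become coordinatewise comparisons. -/
theorem letterMap_apply {n d : ℕ} (hn : 2 ≤ n) (a : Letter n d) (x : Fin d → ℝ) (k : Fin d) :
    (2 * (n : ℝ) - 1) * letterMap n d a x k = x k + offset n d a k := by
  have hn' : (2 : ℝ) ≤ n := by exact_mod_cast hn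
  have h1 : 2 * (n : ℝ) - 1 ≠ 0 := by linarith
  have h2 : (n : ℝ) - 1 ≠ 0 := by linarith
  match a with
  | none =>
    simp only [letterMap, contraction, offset, corner, center, Pi.add_apply, Pi.smul_apply,
      smul_eq_mul]
    push_cast
    field_simp
    ring
  | some (i, r) =>
    have hr : ((n - 1 - (r : ℕ) : ℕ) : ℝ) = n - 1 - (r : ℕ) := by
      rw [Nat.cast_sub (by omega), Nat.cast_sub (by omega)]; simp
    simp only [letterMap, contraction, offset, corner, center, Pi.add_apply, Pi.smul_apply,
      smul_eq_mul, hr]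
    push_cast
    field_simp
    ring

theorem letterMap_eq_iff {n d : ℕ} (hn : 2 ≤ n) {a b : Letter n d} {x y : Fin d → ℝ} :
    letterMap n d a x = letterMap n d b y ↔
      ∀ k, x k + offset n d a k = y k + offset n d b k := by
  have hn' : (2 : ℝ) ≤ n := by exact_mod_cast hn
  have h1 : 2 * (n : ℝ) - 1 ≠ 0 := by linarith
  rw [funext_iff]
  refine forall_congr' fun k => ?_
  rw [← letterMap_apply hn, ← letterMap_apply hn]
  exact ⟨fun h => by rw [h], fun h => mul_left_cancel₀ h1 h⟩

theorem letterMap_injective {n d : ℕ} (hn : 2 ≤ n) (a : Letter n d) :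
    Function.Injective (letterMap n d a) := by
  intro x y h
  rw [letterMap_eq_iff hn] at h
  funext k
  simpa using h k

theorem fin_two_cases (e : Fin 2) : e = 0 ∨ e = 1 := by omega

theorem offset_bounds {n d : ℕ} (hn : 2 ≤ n) (a : Letter n d) (k : Fin d) :
    0 ≤ offset n d a k ∧ offset n d a k ≤ 2 * n - 2 := by
  match a with
  | none => simp only [offset]; omega
  | some (i, r) =>
    rcases fin_two_cases (i k) with h | h <;> simp [offset, h] <;> omega

/-- The unit cube `[0,1]^d`. -/
def cube (d : ℕ) : Set (Fin d → ℝ) := {x | ∀ k, 0 ≤ x k ∧ x k ≤ 1}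

theorem corner_mem_cube {d : ℕ} (e : Fin d → Fin 2) : corner e ∈ cube d := by
  intro k
  rcases fin_two_cases (e k) with h | h <;> simp [corner, h]

theorem corner_injective (d : ℕ) : Function.Injective (corner (d := d)) := by
  intro e e' h
  funext k
  have := congrFun h k
  simp only [corner, Nat.cast_inj] at this
  exact Fin.ext this

theorem letterMap_mem_cube {n d : ℕ} (hn : 2 ≤ n) (a : Letter n d) {x : Fin d → ℝ}
    (hx : x ∈ cube d) : letterMap n d a x ∈ cube d := by
  intro k
  have hn' : (2 : ℝ) ≤ n := by exact_mod_cast hn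
  have h := letterMap_apply hn a x k
  have hb := offset_bounds hn a k
  have h1 : (0 : ℝ) ≤ offset n d a k := by exact_mod_cast hb.1
  have h2 : (offset n d a k : ℝ) ≤ 2 * n - 2 := by exact_mod_cast hb.2
  have := hx k
  constructor
  · by_contra hc
    push Not at hc
    nlinarith
  · by_contra hc
    push Not at hc
    nlinarith

/-- A corner of the cube has no preimages in the cube other than itself. -/
theorem eq_corner_of_letterMap {n d : ℕ} (hn : 2 ≤ n) {a : Letter n d} {x : Fin d → ℝ}
    (hx : x ∈ cube d) {e : Fin d → Fin 2} (h : letterMap n d a x = corner e) : x = corner e := by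
  funext k
  have h1 := letterMap_apply hn a x k
  have hb := offset_bounds hn a k
  have h2 : (0 : ℝ) ≤ offset n d a k := by exact_mod_cast hb.1
  have h3 : (offset n d a k : ℝ) ≤ 2 * n - 2 := by exact_mod_cast hb.2
  have := hx k
  rw [h] at h1
  rcases fin_two_cases (e k) with h | h <;> simp [corner, h] at h1 ⊢ <;> linarith

/-- The opposite corner. -/
def flip {d : ℕ} (e : Fin d → Fin 2) : Fin d → Fin 2 := fun k => 1 - e k

theorem corner_flip {d : ℕ} (e : Fin d → Fin 2) (k : Fin d) :
    corner (flip e) k = 1 - corner e k := by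
  rcases fin_two_cases (e k) with h | h <;> simp [corner, flip, h]

theorem flip_ne {d : ℕ} (hd : 2 ≤ d) (e : Fin d → Fin 2) : flip e ≠ e := by
  intro h
  have := congrFun h ⟨0, by omega⟩
  simp only [flip] at this
  omega

/-- The neighbour, towards the centre, of the cell `some (i, r)`. -/
def inner {n d : ℕ} (i : Fin d → Fin 2) (r : Fin (n - 1)) : Letter n d :=
  if (r : ℕ) = 0 then none else some (i, ⟨r - 1, by omega⟩)

/-- The distance of a cell of level one to the central cell. -/
def rank {n d : ℕ} : Letter n d → ℕ
  | none => 0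
  | some (_, r) => r + 1

theorem rank_some {n d : ℕ} (i : Fin d → Fin 2) (r : Fin (n - 1)) :
    rank (some (i, r) : Letter n d) = r + 1 := rfl

theorem rank_inner {n d : ℕ} (i : Fin d → Fin 2) (r : Fin (n - 1)) :
    rank (inner i r : Letter n d) = r := by
  unfold inner
  split
  · simp [rank, *]
  · simp [rank]; omega

theorem offset_inner {n d : ℕ} (i : Fin d → Fin 2) (r : Fin (n - 1)) (k : Fin d) :
    offset n d (inner i r) k = n - 1 + (2 * (i k : ℕ) - 1) * r := by
  unfold inner
  split
  · simp [offset, *]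
  · simp only [offset]
    rw [Nat.cast_sub (by omega)]
    simp

theorem letterMap_inner {n d : ℕ} (hn : 2 ≤ n) (i : Fin d → Fin 2) (r : Fin (n - 1)) :
    letterMap n d (some (i, r)) (corner (flip i)) = letterMap n d (inner i r) (corner i) := by
  rw [letterMap_eq_iff hn]
  intro k
  rw [corner_flip, offset_inner]
  simp only [offset, corner]
  push_cast
  ring

theorem letterMap_outer {n d : ℕ} (hn : 2 ≤ n) (i : Fin d → Fin 2) :
    letterMap n d (some (i, ⟨n - 2, by omega⟩)) (corner i) = corner i := by
  have hn' : (2 : ℝ) ≤ n := by exact_mod_cast hn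
  have h1 : 2 * (n : ℝ) - 1 ≠ 0 := by linarith
  funext k
  apply mul_left_cancel₀ h1
  rw [letterMap_apply hn]
  simp only [offset, corner]
  push_cast [Nat.cast_sub hn]
  ring

/-- Two distinct cells of level one meet only if they are neighbours, in a common corner. -/
theorem letterMap_touch {n d : ℕ} (hn : 2 ≤ n) (hd : 2 ≤ d) {a b : Letter n d} (hab : a ≠ b)
    {x y : Fin d → ℝ} (hx : x ∈ cube d) (hy : y ∈ cube d)
    (h : letterMap n d a x = letterMap n d b y) :
    ∃ i r, (a = some (i, r) ∧ b = inner i r ∧ x = corner (flip i) ∧ y = corner i) ∨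
      (b = some (i, r) ∧ a = inner i r ∧ y = corner (flip i) ∧ x = corner i) := by
  have key (i : Fin d → Fin 2) (r : Fin (n - 1)) (b : Letter n d) (x y : Fin d → ℝ)
      (hx : x ∈ cube d) (hy : y ∈ cube d)
      (hb : b = inner i r) (h : letterMap n d (some (i, r)) x = letterMap n d b y) :
      x = corner (flip i) ∧ y = corner i := by
    rw [letterMap_eq_iff hn] at h
    rw [funext_iff, funext_iff, ← forall_and]
    intro k
    have hk := h k
    rw [hb, offset_inner] at hk
    have := hx k
    have := hy k
    rw [corner_flip]
    rcases fin_two_cases (i k) with e | e <;> simp [offset, e, corner] at hk ⊢ <;>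
      constructor <;> linarith
  have h' := (letterMap_eq_iff hn).1 h
  have hone (r : Fin (n - 1)) (i : Fin d → Fin 2) (x y : Fin d → ℝ) (hx : x ∈ cube d)
      (hy : y ∈ cube d) (h : letterMap n d (some (i, r)) x = letterMap n d none y) :
      none = (inner i r : Letter n d) := by
    rw [letterMap_eq_iff hn] at h
    have hk := h ⟨0, by omega⟩
    have := hx ⟨0, by omega⟩
    have := hy ⟨0, by omega⟩
    have hr : ((r : ℕ) : ℝ) < 1 := by
      rcases fin_two_cases (i ⟨0, by omega⟩) with e | e <;> simp [offset, e] at hk <;>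
        linarith
    have : (r : ℕ) = 0 := by
      have : (r : ℕ) < 1 := by exact_mod_cast hr
      omega
    simp [inner, this]
  match a, b with
  | none, none => exact absurd rfl hab
  | some (i, r), none =>
    have hb := hone r i x y hx hy h
    exact ⟨i, r, Or.inl ⟨rfl, hb, key i r _ x y hx hy hb h⟩⟩
  | none, some (i, r) =>
    have hb := hone r i y x hy hx h.symm
    exact ⟨i, r, Or.inr ⟨rfl, hb, key i r _ y x hy hx hb h.symm⟩⟩
  | some (i, r), some (i', r') =>
    -- On different arms some coordinate has opposite directions; the offsets there differ by `(r +
    -- 1) + (r' + 1) ≥ 2`, too much for unit cubes to meet.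
    have hi : i = i' := by
      funext k
      have hk := h' k
      have := hx k
      have := hy k
      rcases fin_two_cases (i k) with e | e <;> rcases fin_two_cases (i' k) with e' | e' <;>
        simp [offset, e, e'] at hk ⊢
      · have : (0 : ℝ) ≤ (r : ℕ) := Nat.cast_nonneg _
        have : (0 : ℝ) ≤ (r' : ℕ) := Nat.cast_nonneg _
        linarith
      · have : (0 : ℝ) ≤ (r : ℕ) := Nat.cast_nonneg _
        have : (0 : ℝ) ≤ (r' : ℕ) := Nat.cast_nonneg _
        linarith
    subst hi
    have hk := h' ⟨0, by omega⟩
    have := hx ⟨0, by omega⟩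
    have := hy ⟨0, by omega⟩
    have hrr : (r : ℕ) ≠ r' := fun e => hab (by rw [Fin.ext e])
    have hr : (r : ℕ) ≤ r' + 1 ∧ (r' : ℕ) ≤ r + 1 := by
      have : ((r : ℕ) : ℝ) ≤ (r' : ℕ) + 1 ∧ ((r' : ℕ) : ℝ) ≤ (r : ℕ) + 1 := by
        rcases fin_two_cases (i ⟨0, by omega⟩) with e | e <;> simp [offset, e] at hk <;>
          constructor <;> linarith
      exact_mod_cast this
    rcases lt_or_gt_of_ne hrr with hlt | hlt
    · have hb : some (i, r) = (inner i r' : Letter n d) := by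
        rw [inner, if_neg (by omega)]
        congr 2; ext; simp; omega
      exact ⟨i, r', Or.inr ⟨rfl, hb, key i r' _ y x hy hx hb h.symm⟩⟩
    · have hb : some (i, r') = (inner i r : Letter n d) := by
        rw [inner, if_neg (by omega)]
        congr 2; ext; simp; omega
      exact ⟨i, r, Or.inl ⟨rfl, hb, key i r _ x y hx hy hb h⟩⟩

/-- Two distinct cells of level one have at most one common point, which is a corner of both. -/
theorem letterMap_touch_unique {n d : ℕ} (hn : 2 ≤ n) (hd : 2 ≤ d) {a b : Letter n d}
    (hab : a ≠ b) : ∃ e e' : Fin d → Fin 2, ∀ x ∈ cube d, ∀ y ∈ cube d,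
      letterMap n d a x = letterMap n d b y → x = corner e ∧ y = corner e' := by
  by_cases hex : ∃ x ∈ cube d, ∃ y ∈ cube d, letterMap n d a x = letterMap n d b y
  · obtain ⟨x, hx, y, hy, h⟩ := hex
    obtain ⟨i, r, ⟨ha, hb, -, -⟩ | ⟨hb, ha, -, -⟩⟩ := letterMap_touch hn hd hab hx hy h
    · refine ⟨flip i, i, fun x hx y hy h => ?_⟩
      obtain ⟨i', r', ⟨ha', hb', h1, h2⟩ | ⟨hb', ha', h1, h2⟩⟩ := letterMap_touch hn hd hab hx hy h
      · rw [ha, Option.some_inj, Prod.mk.injEq] at ha'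
        rw [ha'.1]
        exact ⟨h1, h2⟩
      · have e1 := congrArg rank ha
        have e2 := congrArg rank hb
        have e3 := congrArg rank ha'
        have e4 := congrArg rank hb'
        rw [rank_inner] at e2 e3
        rw [rank_some] at e1 e4
        omega
    · refine ⟨i, flip i, fun x hx y hy h => ?_⟩
      obtain ⟨i', r', ⟨ha', hb', h1, h2⟩ | ⟨hb', ha', h1, h2⟩⟩ := letterMap_touch hn hd hab hx hy h
      · have e1 := congrArg rank ha
        have e2 := congrArg rank hb
        have e3 := congrArg rank ha'
        have e4 := congrArg rank hb'
        rw [rank_inner] at e1 e4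
        rw [rank_some] at e2 e3
        omega
      · rw [hb, Option.some_inj, Prod.mk.injEq] at hb'
        rw [hb'.1]
        exact ⟨h2, h1⟩
  · exact ⟨0, 0, fun x hx y hy h => absurd ⟨x, hx, y, hy, h⟩ hex⟩

/-! ### Cells of level `m`, and vertices and edges in terms of addresses. -/

/-- The map onto the cell of level `m` with address `w`. -/
def cellMap (n d m : ℕ) (w : Fin m → Letter n d) (x : Fin d → ℝ) : Fin d → ℝ :=
  (List.ofFn w).foldr (letterMap n d) x

theorem cellMap_succ (n d m : ℕ) (w : Fin (m + 1) → Letter n d) (x : Fin d → ℝ) :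
    cellMap n d (m + 1) w x = letterMap n d (w 0) (cellMap n d m (Fin.tail w) x) := by
  simp [cellMap, List.ofFn_succ, Fin.tail_def]

theorem cellMap_succ' (n d m : ℕ) (w : Fin (m + 1) → Letter n d) (x : Fin d → ℝ) :
    cellMap n d (m + 1) w x =
      cellMap n d m (Fin.init w) (letterMap n d (w (Fin.last m)) x) := by
  rw [cellMap, List.ofFn_succ', List.concat_eq_append, List.foldr_append]
  rfl

theorem cellMap_cons (n d m : ℕ) (a : Letter n d) (w : Fin m → Letter n d) (x : Fin d → ℝ) :
    cellMap n d (m + 1) (Fin.cons a w) x = letterMap n d a (cellMap n d m w x) := by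
  rw [cellMap_succ]; simp

theorem cellMap_snoc (n d m : ℕ) (w : Fin m → Letter n d) (a : Letter n d) (x : Fin d → ℝ) :
    cellMap n d (m + 1) (Fin.snoc w a) x = cellMap n d m w (letterMap n d a x) := by
  rw [cellMap_succ']; simp

theorem cellMap_mem_cube {n d : ℕ} (hn : 2 ≤ n) (m : ℕ) (w : Fin m → Letter n d)
    {x : Fin d → ℝ} (hx : x ∈ cube d) : cellMap n d m w x ∈ cube d := by
  induction m with
  | zero => simpa [cellMap] using hx
  | succ m ih => rw [cellMap_succ]; exact letterMap_mem_cube hn _ (ih _)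

theorem cellMap_injective {n d : ℕ} (hn : 2 ≤ n) (m : ℕ) (w : Fin m → Letter n d) :
    Function.Injective (cellMap n d m w) := by
  induction m with
  | zero => intro x y h; simpa [cellMap] using h
  | succ m ih =>
    intro x y h
    rw [cellMap_succ, cellMap_succ] at h
    exact ih _ (letterMap_injective hn _ h)

theorem eq_corner_of_cellMap {n d : ℕ} (hn : 2 ≤ n) {m : ℕ} {w : Fin m → Letter n d}
    {x : Fin d → ℝ} (hx : x ∈ cube d) {e : Fin d → Fin 2} (h : cellMap n d m w x = corner e) :
    x = corner e := by
  induction m with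
  | zero => simpa [cellMap] using h
  | succ m ih =>
    rw [cellMap_succ] at h
    exact ih (eq_corner_of_letterMap hn (cellMap_mem_cube hn m _ hx) h)

/-- Two distinct cells of level `m` have at most one common point, which is a corner of both. -/
theorem cellMap_touch_unique {n d : ℕ} (hn : 2 ≤ n) (hd : 2 ≤ d) {m : ℕ}
    {w w' : Fin m → Letter n d} (hw : w ≠ w') :
    ∃ e e' : Fin d → Fin 2, ∀ x ∈ cube d, ∀ y ∈ cube d,
      cellMap n d m w x = cellMap n d m w' y → x = corner e ∧ y = corner e' := by
  induction m with
  | zero => exact absurd (Subsingleton.elim _ _) hw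
  | succ m ih =>
    simp only [cellMap_succ]
    by_cases h0 : w 0 = w' 0
    · have ht : Fin.tail w ≠ Fin.tail w' := by
        intro ht
        apply hw
        rw [← Fin.cons_self_tail w, ← Fin.cons_self_tail w', h0, ht]
      obtain ⟨e, e', h⟩ := ih ht
      refine ⟨e, e', fun x hx y hy hxy => h x hx y hy ?_⟩
      rw [h0] at hxy
      exact letterMap_injective hn _ hxy
    -- The contact point is a corner of the two level-one cells, and a subcell can reach a corner of
    -- the cube only with its own corresponding corner.
    · obtain ⟨e, e', h⟩ := letterMap_touch_unique hn hd h0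
      refine ⟨e, e', fun x hx y hy hxy => ?_⟩
      obtain ⟨h1, h2⟩ := h _ (cellMap_mem_cube hn m _ hx) _ (cellMap_mem_cube hn m _ hy) hxy
      exact ⟨eq_corner_of_cellMap hn hx h1, eq_corner_of_cellMap hn hy h2⟩

/-- For `j = n` the coefficient of the corner vanishes, so all directions share one central cell;
this is why the alphabet has `2^d (n-1) + 1` letters. -/
theorem contraction_last {n d : ℕ} (i : Fin d → Fin 2) : contraction n i n = letterMap n d none := by
  funext x
  simp [letterMap, contraction]

theorem exists_letterMap {n d : ℕ} (i : Fin d → Fin 2) {j : ℕ} (hj : j ∈ Set.Icc 1 n) :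
    ∃ a : Letter n d, contraction n i j = letterMap n d a := by
  by_cases h : j = n
  · subst h; exact ⟨none, contraction_last i⟩
  · obtain ⟨h1, h2⟩ := hj
    refine ⟨some (i, ⟨n - 1 - j, by omega⟩), ?_⟩
    simp only [letterMap]
    congr 1; omega

theorem exists_contraction {n d : ℕ} (hn : 2 ≤ n) (a : Letter n d) :
    ∃ i, ∃ j ∈ Set.Icc 1 n, contraction n i j = letterMap n d a := by
  match a with
  | none => exact ⟨0, n, ⟨by omega, le_rfl⟩, rfl⟩
  | some (i, r) => exact ⟨i, n - 1 - r, ⟨by omega, by omega⟩, rfl⟩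

theorem mem_vertices_succ {n d : ℕ} (hn : 2 ≤ n) {m : ℕ} {x : Fin d → ℝ} :
    x ∈ vertices n d (m + 1) ↔ ∃ a, ∃ v ∈ vertices n d m, letterMap n d a v = x := by
  simp only [vertices, Set.mem_iUnion, Set.mem_image]
  constructor
  · rintro ⟨i, j, hj, v, hv, rfl⟩
    obtain ⟨a, ha⟩ := exists_letterMap (d := d) i hj
    exact ⟨a, v, hv, by rw [ha]⟩
  · rintro ⟨a, v, hv, rfl⟩
    obtain ⟨i, j, hj, ha⟩ := exists_contraction hn a
    exact ⟨i, j, hj, v, hv, by rw [ha]⟩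

theorem mem_vertices_iff {n d : ℕ} (hn : 2 ≤ n) {m : ℕ} {x : Fin d → ℝ} :
    x ∈ vertices n d m ↔ ∃ w e, cellMap n d m w (corner e) = x := by
  induction m generalizing x with
  | zero =>
    simp only [vertices, Set.mem_range, cellMap, List.ofFn_zero, List.foldr_nil]
    exact ⟨fun ⟨e, h⟩ => ⟨Fin.elim0, e, h⟩, fun ⟨_, e, h⟩ => ⟨e, h⟩⟩
  | succ m ih =>
    rw [mem_vertices_succ hn]
    constructor
    · rintro ⟨a, v, hv, rfl⟩
      obtain ⟨w, e, rfl⟩ := ih.1 hv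
      exact ⟨Fin.cons a w, e, cellMap_cons n d m a w _⟩
    · rintro ⟨w, e, rfl⟩
      exact ⟨w 0, _, ih.2 ⟨Fin.tail w, e, rfl⟩, (cellMap_succ n d m w _).symm⟩

theorem mem_edges_iff {n d : ℕ} (hn : 2 ≤ n) {m : ℕ} {s : Sym2 (Fin d → ℝ)} :
    s ∈ edges n d m ↔ ∃ w e e', e ≠ e' ∧
      s = s(cellMap n d m w (corner e), cellMap n d m w (corner e')) := by
  induction m generalizing s with
  | zero =>
    simp only [edges, Set.mem_ofPred_eq, cellMap, List.ofFn_zero, List.foldr_nil]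
    exact ⟨fun ⟨e, h⟩ => ⟨Fin.elim0, e, h⟩, fun ⟨_, e, h⟩ => ⟨e, h⟩⟩
  | succ m ih =>
    simp only [edges, Set.mem_iUnion, Set.mem_image]
    constructor
    · rintro ⟨i, j, hj, v, hv, rfl⟩
      obtain ⟨a, ha⟩ := exists_letterMap (d := d) i hj
      obtain ⟨w, e, e', hne, rfl⟩ := ih.1 hv
      refine ⟨Fin.cons a w, e, e', hne, ?_⟩
      rw [cellMap_cons, cellMap_cons, Sym2.map_mk, ha]
    · rintro ⟨w, e, e', hne, rfl⟩
      obtain ⟨i, j, hj, ha⟩ := exists_contraction hn (w 0)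
      refine ⟨i, j, hj, _, ih.2 ⟨Fin.tail w, e, e', hne, rfl⟩, ?_⟩
      rw [cellMap_succ, cellMap_succ, Sym2.map_mk, ha]

theorem corner_mem_vertices {n d : ℕ} (hn : 2 ≤ n) (m : ℕ) (e : Fin d → Fin 2) :
    corner e ∈ vertices n d m := by
  induction m with
  | zero => exact ⟨e, rfl⟩
  | succ m ih => exact (mem_vertices_succ hn).2 ⟨_, _, ih, letterMap_outer hn e⟩

theorem vertices_subset_cube {n d : ℕ} (hn : 2 ≤ n) (m : ℕ) : vertices n d m ⊆ cube d := by
  intro x hx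
  obtain ⟨w, e, rfl⟩ := (mem_vertices_iff hn).1 hx
  exact cellMap_mem_cube hn m w (corner_mem_cube e)

theorem card_letter (n d : ℕ) :
    Fintype.card (Letter n d) = 2 ^ d * n - 2 ^ d + 1 := by
  simp [Letter, Nat.mul_sub]

/-! ### The number of vertices. -/

/-- The corner of a cell of level one shared with its inner neighbour. -/
def shared {n d : ℕ} : Letter n d → Set (Fin d → ℝ)
  | none => ∅
  | some (i, _) => {corner (flip i)}

/-- The cells of level one form a tree. Deleting from each arm cell the corner it shares with its
inner neighbour makes the pieces disjoint without losing a vertex. -/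
theorem ncard_vertices_succ {n d : ℕ} (hn : 2 ≤ n) (hd : 2 ≤ d) (m : ℕ) :
    (vertices n d (m + 1)).ncard = 2 ^ d * (n - 1) * ((vertices n d m).ncard - 1)
      + (vertices n d m).ncard := by
  classical
  have hfin := vertices_finite n d m
  have hcover : vertices n d (m + 1) =
      ⋃ a : Letter n d, letterMap n d a '' (vertices n d m \ shared a) := by
    ext x
    rw [mem_vertices_succ hn]
    simp only [Set.mem_iUnion, Set.mem_image, Set.mem_sdiff]
    constructor
    · rintro ⟨a, v, hv, rfl⟩
      by_cases hs : v ∈ shared a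
      · match a, hs with
        | some (i, r), hs =>
          obtain rfl : v = corner (flip i) := hs
          refine ⟨inner i r, corner i, ⟨corner_mem_vertices hn m i, ?_⟩,
            (letterMap_inner hn i r).symm⟩
          unfold inner
          split
          · simp [shared]
          · simp only [shared, Set.mem_singleton_iff]
            exact fun h => flip_ne hd i (corner_injective d h).symm
      · exact ⟨a, v, ⟨hv, hs⟩, rfl⟩
    · rintro ⟨a, v, ⟨hv, -⟩, rfl⟩
      exact ⟨a, v, hv, rfl⟩
  have hdisj : Pairwise fun a b : Letter n d => Disjoint
      (letterMap n d a '' (vertices n d m \ shared a))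
      (letterMap n d b '' (vertices n d m \ shared b)) := by
    intro a b hab
    rw [Set.disjoint_left]
    rintro _ ⟨x, ⟨hx, hxs⟩, rfl⟩ ⟨y, ⟨hy, hys⟩, h⟩
    obtain ⟨i, r, ⟨rfl, -, rfl, -⟩ | ⟨rfl, -, rfl, -⟩⟩ := letterMap_touch hn hd hab
      (vertices_subset_cube hn m hx) (vertices_subset_cube hn m hy) h.symm
    · exact hxs rfl
    · exact hys rfl
  have hcard : (vertices n d (m + 1)).ncard =
      ∑ a : Letter n d, (letterMap n d a '' (vertices n d m \ shared a)).ncard := by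
    rw [hcover, Set.ncard_iUnion_of_finite (fun a => (hfin.sdiff).image _) hdisj,
      finsum_eq_sum_of_fintype]
  have hpiece (a : Letter n d) : (letterMap n d a '' (vertices n d m \ shared a)).ncard =
      (vertices n d m \ shared a).ncard := Set.ncard_image_of_injective _ (letterMap_injective hn a)
  rw [hcard, Fintype.sum_option, hpiece, add_comm]
  congr 1
  · have (p : (Fin d → Fin 2) × Fin (n - 1)) :
        (letterMap n d (some p) '' (vertices n d m \ shared (some p))).ncard =
          (vertices n d m).ncard - 1 := by
      rw [hpiece]
      exact Set.ncard_sdiff_singleton_of_mem (corner_mem_vertices hn m _)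
    simp [this]
  · simp [shared]

theorem ncard_vertices {n d : ℕ} (hn : 2 ≤ n) (hd : 2 ≤ d) (m : ℕ) :
    (vertices n d m).ncard = (2 ^ d * n - 2 ^ d + 1) ^ m * (2 ^ d - 1) + 1 := by
  have hpos : 1 ≤ 2 ^ d := Nat.one_le_two_pow
  induction m with
  | zero =>
    rw [vertices, ← Set.image_univ, Set.ncard_image_of_injective _ (corner_injective d),
      Set.ncard_univ]
    simp
    omega
  | succ m ih =>
    rw [ncard_vertices_succ hn hd, ih, Nat.add_sub_cancel, Nat.mul_sub, mul_one]
    ring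

/-! ### The eigenvalue equation cell by cell. -/

/-- The vertex of `V_m` with a given address. -/
def vert {n d : ℕ} (hn : 2 ≤ n) (m : ℕ) (w : Fin m → Letter n d) (e : Fin d → Fin 2) :
    vertices n d m :=
  ⟨cellMap n d m w (corner e), (mem_vertices_iff hn).2 ⟨w, e, rfl⟩⟩

theorem vert_eq_iff {n d : ℕ} (hn : 2 ≤ n) {m : ℕ} {w w' : Fin m → Letter n d}
    {e e' : Fin d → Fin 2} : vert hn m w e = vert hn m w' e' ↔
      cellMap n d m w (corner e) = cellMap n d m w' (corner e') := Subtype.ext_iff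

theorem vert_surjective {n d : ℕ} (hn : 2 ≤ n) {m : ℕ} (x : vertices n d m) :
    ∃ w e, vert hn m w e = x := by
  obtain ⟨w, e, h⟩ := (mem_vertices_iff hn).1 x.2
  exact ⟨w, e, Subtype.ext h⟩

theorem vert_injective {n d : ℕ} (hn : 2 ≤ n) {m : ℕ} (w : Fin m → Letter n d) :
    Function.Injective (vert hn m w) := fun _ _ h =>
  corner_injective d (cellMap_injective hn m w ((vert_eq_iff hn).1 h))

theorem graph_adj_iff {n d : ℕ} (hn : 2 ≤ n) {m : ℕ} {x y : vertices n d m} :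
    (graph n d m).Adj x y ↔ ∃ w e e', e ≠ e' ∧ vert hn m w e = x ∧ vert hn m w e' = y := by
  simp only [graph, SimpleGraph.comap_adj, Function.Embedding.subtype_apply,
    SimpleGraph.fromEdgeSet_adj, mem_edges_iff hn]
  constructor
  · rintro ⟨⟨w, e, e', hne, h⟩, -⟩
    rcases Sym2.eq_iff.1 h with ⟨h1, h2⟩ | ⟨h1, h2⟩
    · exact ⟨w, e, e', hne, Subtype.ext h1.symm, Subtype.ext h2.symm⟩
    · exact ⟨w, e', e, hne.symm, Subtype.ext h1.symm, Subtype.ext h2.symm⟩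
  · rintro ⟨w, e, e', hne, rfl, rfl⟩
    exact ⟨⟨w, e, e', hne, rfl⟩, fun h => hne (vert_injective hn w (Subtype.ext h))⟩

/-- Distinct cells have at most one common point; hence each edge belongs to a single cell, and sums
over neighbours split over cells without repetition. -/
theorem eq_of_common_edge {n d : ℕ} (hn : 2 ≤ n) (hd : 2 ≤ d) {m : ℕ} {w w' : Fin m → Letter n d}
    {e e' f f' : Fin d → Fin 2} (hne : e ≠ f) (h : vert hn m w e = vert hn m w' e')
    (h' : vert hn m w f = vert hn m w' f') : w = w' := by
  by_contra hw
  obtain ⟨g, g', hg⟩ := cellMap_touch_unique hn hd hw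
  have h1 := hg _ (corner_mem_cube e) _ (corner_mem_cube e') ((vert_eq_iff hn).1 h)
  have h2 := hg _ (corner_mem_cube f) _ (corner_mem_cube f') ((vert_eq_iff hn).1 h')
  exact hne (corner_injective d (h1.1.trans h2.1.symm))

/-- The sum of the values of `f` at the corners of a cell. -/
def cellSum {n d : ℕ} (hn : 2 ≤ n) {m : ℕ} (f : vertices n d m → ℝ) (w : Fin m → Letter n d) : ℝ :=
  ∑ e, f (vert hn m w e)

open Classical in
theorem sum_neighborFinset {n d : ℕ} (hn : 2 ≤ n) (hd : 2 ≤ d) {m : ℕ} (f : vertices n d m → ℝ)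
    (x : vertices n d m) :
    ∑ y ∈ (graph n d m).neighborFinset x, f y =
      ∑ w, ∑ e, if vert hn m w e = x then cellSum hn f w - f x else 0 := by
  have h1 : ∑ p : (Fin m → Letter n d) × (Fin d → Fin 2) × (Fin d → Fin 2) with
      vert hn m p.1 p.2.1 = x ∧ p.2.2 ≠ p.2.1, f (vert hn m p.1 p.2.2) =
      ∑ y ∈ (graph n d m).neighborFinset x, f y := by
    refine Finset.sum_bij (fun p _ => vert hn m p.1 p.2.2) ?_ ?_ ?_ (fun _ _ => rfl)
    · rintro ⟨w, e, e'⟩ hp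
      simp only [Finset.mem_filter, Finset.mem_univ, true_and] at hp
      rw [SimpleGraph.mem_neighborFinset, graph_adj_iff hn]
      exact ⟨w, e, e', hp.2.symm, hp.1, rfl⟩
    · rintro ⟨w, e, e'⟩ hp ⟨w', f, f'⟩ hp' h
      simp only [Finset.mem_filter, Finset.mem_univ, true_and] at hp hp' h
      obtain rfl : w = w' := eq_of_common_edge hn hd hp.2.symm (hp.1.trans hp'.1.symm) h
      rw [vert_injective hn w h, vert_injective hn w (hp.1.trans hp'.1.symm)]
    · intro y hy
      rw [SimpleGraph.mem_neighborFinset, graph_adj_iff hn] at hy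
      obtain ⟨w, e, e', hne, h1, h2⟩ := hy
      exact ⟨(w, e, e'), by simp [h1, hne.symm], h2⟩
  rw [← h1, Finset.sum_filter, Fintype.sum_prod_type]
  refine Finset.sum_congr rfl fun w _ => ?_
  rw [Fintype.sum_prod_type]
  refine Finset.sum_congr rfl fun e _ => ?_
  split
  · next h =>
    simp only [h, true_and]
    rw [← Finset.sum_filter, cellSum, ← h, Finset.filter_ne', Finset.sum_erase_eq_sub (by simp)]
  · next h => simp [h]

open Classical in
/-- The eigenvalue equation, written cell by cell. -/
theorem mem_eigenspace_iff {n d : ℕ} (hn : 2 ≤ n) (hd : 2 ≤ d) {m : ℕ} {μ : ℝ}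
    {f : vertices n d m → ℝ} :
    f ∈ Module.End.eigenspace (-laplacian n d m) μ ↔ ∀ x, ∑ w, ∑ e,
      (if vert hn m w e = x then cellSum hn f w - (2 ^ d - (2 ^ d - 1) * μ) * f x else 0) = 0 := by
  rw [Module.End.mem_eigenspace_iff, funext_iff]
  refine forall_congr' fun x => ?_
  have h4 := four_le_two_pow hd
  -- `c` is the number of cells containing `x`. Each contributes `2^d - 1` neighbours, so
  -- multiplying the equation by the degree clears the normalization.
  set c : ℝ := ∑ w, ∑ e, if vert hn m w e = x then (1 : ℝ) else 0 with hc
  have hcpos : 0 < c := by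
    obtain ⟨w, e, h⟩ := vert_surjective hn x
    have hnn (w) (e) : 0 ≤ if vert hn m w e = x then (1 : ℝ) else 0 := by split <;> norm_num
    calc (0 : ℝ) < if vert hn m w e = x then (1 : ℝ) else 0 := by rw [if_pos h]; norm_num
      _ ≤ ∑ e, if vert hn m w e = x then (1 : ℝ) else 0 :=
        Finset.single_le_sum (fun e _ => hnn w e) (Finset.mem_univ e)
      _ ≤ c := Finset.single_le_sum (f := fun w => ∑ e, if vert hn m w e = x then (1 : ℝ) else 0)
        (fun w _ => Finset.sum_nonneg fun e _ => hnn w e) (Finset.mem_univ w)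
  have hmul (a : ℝ) : ∑ w, ∑ e, (if vert hn m w e = x then a else 0) = a * c := by
    rw [hc, Finset.mul_sum]
    refine Finset.sum_congr rfl fun w _ => ?_
    rw [Finset.mul_sum]
    exact Finset.sum_congr rfl fun e _ => by split <;> simp
  have hdeg : ((graph n d m).degree x : ℝ) = (2 ^ d - 1) * c := by
    have h := sum_neighborFinset hn hd (fun _ => (1 : ℝ)) x
    simp only [Finset.sum_const, SimpleGraph.card_neighborFinset_eq_degree, nsmul_eq_mul,
      mul_one, cellSum, Finset.card_univ] at h
    rw [h, hmul]
    simp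
  have hsum : ∑ w, ∑ e, (if vert hn m w e = x then
        cellSum hn f w - (2 ^ d - (2 ^ d - 1) * μ) * f x else 0) =
      ∑ y ∈ (graph n d m).neighborFinset x, f y - (2 ^ d - 1) * c * (1 - μ) * f x := by
    rw [sum_neighborFinset hn hd, eq_sub_iff_add_eq,
      show (2 ^ d - 1) * c * (1 - μ) * f x = ((2 ^ d - 1) * (1 - μ) * f x) * c by ring,
      ← hmul, ← Finset.sum_add_distrib]
    refine Finset.sum_congr rfl fun w _ => ?_
    rw [← Finset.sum_add_distrib]
    refine Finset.sum_congr rfl fun e _ => ?_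
    split
    · ring
    · simp
  have hne : (2 ^ d - 1) * c ≠ 0 := (mul_pos (by linarith) hcpos).ne'
  rw [hsum]
  simp only [LinearMap.neg_apply, Pi.neg_apply, Pi.smul_apply, smul_eq_mul, laplacian,
    LinearMap.coe_mk, AddHom.coe_mk, hdeg]
  set s := ∑ y ∈ (graph n d m).neighborFinset x, f y
  constructor
  · intro h
    have : ((2 ^ d - 1) * c)⁻¹ * s = (1 - μ) * f x := by linarith
    rw [inv_mul_eq_iff_eq_mul₀ hne] at this
    rw [this]; ring
  · intro h
    have : ((2 ^ d - 1) * c)⁻¹ * s = (1 - μ) * f x := by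
      rw [inv_mul_eq_iff_eq_mul₀ hne]; linarith
    rw [this]; ring

theorem card_vertices {n d : ℕ} (hn : 2 ≤ n) (hd : 2 ≤ d) (m : ℕ) :
    Module.finrank ℝ (vertices n d m → ℝ) = (2 ^ d * n - 2 ^ d + 1) ^ m * (2 ^ d - 1) + 1 := by
  rw [Module.finrank_fintype_fun_eq_card, ← Nat.card_eq_fintype_card, Nat.card_coe_set_eq,
    ncard_vertices hn hd]

/-! ### Lower bounds at the two seeds. -/

theorem one_le_multiplicity {n d m : ℕ} {μ : ℝ} {f : vertices n d m → ℝ} (hf : f ≠ 0)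
    (h : f ∈ Module.End.eigenspace (-laplacian n d m) μ) : 1 ≤ neumannMultiplicity n d m μ := by
  rw [neumannMultiplicity, Nat.one_le_iff_ne_zero]
  intro h0
  rw [Submodule.finrank_eq_zero] at h0
  rw [h0, Submodule.mem_bot] at h
  exact hf h

theorem one_le_multiplicity_zero {n d : ℕ} (hn : 2 ≤ n) (hd : 2 ≤ d) (m : ℕ) :
    1 ≤ neumannMultiplicity n d m 0 := by
  refine one_le_multiplicity (f := fun _ => 1) ?_ ((mem_eigenspace_iff hn hd).2 fun x => ?_)
  · intro h
    have := congrFun h ⟨_, corner_mem_vertices hn m 0⟩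
    simp at this
  · simp [cellSum]

/-- Functions with vanishing cell sums are eigenfunctions for `2^d / (2^d - 1)`. -/
theorem le_multiplicity_top {n d : ℕ} (hn : 2 ≤ n) (hd : 2 ≤ d) (m : ℕ) :
    (2 ^ d * n - 2 ^ d + 1) ^ m * (2 ^ d - 2) + 1 ≤ neumannMultiplicity n d m (topValue d) := by
  -- The kernel has codimension at most the number of cells; no independence of the cell-sum
  -- conditions is needed.
  let T : (vertices n d m → ℝ) →ₗ[ℝ] ((Fin m → Letter n d) → ℝ) :=
    { toFun := fun f w => cellSum hn f w
      map_add' := fun f g => by funext w; simp [cellSum, Finset.sum_add_distrib]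
      map_smul' := fun a f => by funext w; simp [cellSum, Finset.mul_sum] }
  have hker : LinearMap.ker T ≤ Module.End.eigenspace (-laplacian n d m) (topValue d) := by
    intro f hf
    have h0 : ∀ w, cellSum hn f w = 0 := fun w => congrFun (LinearMap.mem_ker.1 hf) w
    rw [mem_eigenspace_iff hn hd]
    intro x
    simp [h0, mul_topValue hd]
  have h1 := Submodule.finrank_mono hker
  have h2 := T.finrank_range_add_finrank_ker
  have h3 := Submodule.finrank_le (LinearMap.range T)
  rw [card_vertices hn hd] at h2
  rw [Module.finrank_fintype_fun_eq_card, Fintype.card_fun, Fintype.card_fin, card_letter] at h3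
  rw [neumannMultiplicity]
  have hpos : 2 ≤ 2 ^ d := by
    calc 2 = 2 ^ 1 := by norm_num
      _ ≤ 2 ^ d := Nat.pow_le_pow_right (by norm_num) (by omega)
  set c := (2 ^ d * n - 2 ^ d + 1) ^ m
  have : c * (2 ^ d - 1) = c * (2 ^ d - 2) + c := by
    rw [← Nat.mul_succ]; congr 1; omega
  omega

/-! ### Extension of corner values into a subdivided cell. -/

/-- The value at the `k`-th arm vertex, counted from the centre, of the solution along an arm with
central vertex value `v` and normalized central cell sum `s`. -/
def armVertex (d : ℕ) (x v s : ℝ) (k : ℕ) : ℝ :=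
  (chebU d k x + chebU d (k - 1) x) * v - (1 + tVal d x) * chebU d (k - 1) x * s

/-- The value at the free vertices of the `k`-th arm cell, counted from the centre. -/
def armFree (d : ℕ) (x v s : ℝ) (k : ℕ) : ℝ :=
  2 * chebU d (k - 1) x * v + (chebU d k x - (1 + 2 * tVal d x) * chebU d (k - 1) x) * s

theorem armVertex_zero (d : ℕ) (x v s : ℝ) : armVertex d x v s 0 = v := by
  simp [armVertex, chebU_neg_one, chebU_zero]

theorem armFree_zero (d : ℕ) (x v s : ℝ) : armFree d x v s 0 = s := by
  simp [armFree, chebU_neg_one, chebU_zero]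

/-- This is the eigenvalue equation at the junction of two consecutive arm cells: the value at a
free vertex equals the cell sum divided by `2^d - 1 + t`, and the two normalized sums must average
to the junction value. -/
theorem armFree_succ (d : ℕ) (x v s : ℝ) (k : ℕ) :
    armFree d x v s (k + 1) + armFree d x v s k = 2 * armVertex d x v s k := by
  have h := chebU_add_one d k x
  simp only [armFree, armVertex]
  push_cast
  rw [add_sub_cancel_right, h]
  ring

/-- Expresses that the two arm vertices and the `2^d - 2` free vertices of a cell add up to `2^d - 1
+ t` times the free value. -/
theorem armVertex_succ (d : ℕ) (x v s : ℝ) (k : ℕ) :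
    armVertex d x v s (k + 1) + armVertex d x v s k =
      (1 + tVal d x) * armFree d x v s (k + 1) := by
  have h := chebU_add_one d k x
  simp only [armFree, armVertex]
  push_cast
  rw [add_sub_cancel_right, h]
  ring

/-- The normalized sum over the central cell of the extension of the corner values `b`. -/
def centreSum (n d : ℕ) (x : ℝ) (b : (Fin d → Fin 2) → ℝ) : ℝ := (∑ e, b e) / topFactor n d x

/-- The corner values on the central cell of the extension of the corner values `b`. -/
def centreValue (n d : ℕ) (x : ℝ) (b : (Fin d → Fin 2) → ℝ) (i : Fin d → Fin 2) : ℝ :=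
  (b i + (1 + tVal d x) * chebU d (n - 2) x * centreSum n d x b) / sumFactor n d x

/-- Consistency of the central cell. Each centre value is obtained by solving for the prescribed
outer value of its arm, with coefficient `sumFactor`; summing over the arms leaves one equation for
the central sum, with coefficient `topFactor`. -/
theorem sum_centreValue {n d : ℕ} {x : ℝ} (hA : sumFactor n d x ≠ 0) (hQ : topFactor n d x ≠ 0)
    (b : (Fin d → Fin 2) → ℝ) :
    ∑ i, centreValue n d x b i = (2 ^ d - 1 + tVal d x) * centreSum n d x b := by
  have hT : ∑ e, b e = topFactor n d x * centreSum n d x b := by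
    rw [centreSum]; field_simp
  simp only [centreValue]
  rw [← Finset.sum_div, Finset.sum_add_distrib, hT, div_eq_iff hA]
  simp only [Finset.sum_const, Finset.card_univ, Fintype.card_fun, Fintype.card_fin, nsmul_eq_mul]
  rw [topFactor, sumFactor]
  push_cast
  ring

/-- The extension of corner values `b` to the vertices of level one, in terms of addresses. -/
def localExt (n d : ℕ) (x : ℝ) (b : (Fin d → Fin 2) → ℝ) : Letter n d → (Fin d → Fin 2) → ℝ
  | none, e => centreValue n d x b e
  | some (i, r), e =>
    if e = i then armVertex d x (centreValue n d x b i) (centreSum n d x b) (r + 1)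
    else if e = flip i then armVertex d x (centreValue n d x b i) (centreSum n d x b) r
    else armFree d x (centreValue n d x b i) (centreSum n d x b) (r + 1)

theorem localExt_inner {n d : ℕ} (x : ℝ) (b : (Fin d → Fin 2) → ℝ) (i : Fin d → Fin 2)
    (r : Fin (n - 1)) : localExt n d x b (inner i r) i =
      armVertex d x (centreValue n d x b i) (centreSum n d x b) r := by
  unfold inner
  split
  · next h => rw [localExt, h, armVertex_zero]
  · next h =>
    simp only [localExt, if_true]
    rw [Nat.sub_add_cancel (by omega)]

theorem localExt_flip {n d : ℕ} (hd : 2 ≤ d) (x : ℝ) (b : (Fin d → Fin 2) → ℝ)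
    (i : Fin d → Fin 2) (r : Fin (n - 1)) : localExt n d x b (some (i, r)) (flip i) =
      armVertex d x (centreValue n d x b i) (centreSum n d x b) r := by
  simp [localExt, flip_ne hd i]

theorem localExt_congr {n d : ℕ} (hn : 2 ≤ n) (hd : 2 ≤ d) (x : ℝ) (b : (Fin d → Fin 2) → ℝ)
    {a a' : Letter n d} {e e' : Fin d → Fin 2}
    (h : letterMap n d a (corner e) = letterMap n d a' (corner e')) :
    localExt n d x b a e = localExt n d x b a' e' := by
  by_cases ha : a = a'
  · subst ha
    rw [corner_injective d (letterMap_injective hn a h)]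
  · obtain ⟨i, r, ⟨rfl, rfl, h1, h2⟩ | ⟨rfl, rfl, h1, h2⟩⟩ := letterMap_touch hn hd ha
      (corner_mem_cube e) (corner_mem_cube e') h
    · rw [corner_injective d h1, corner_injective d h2, localExt_inner, localExt_flip hd]
    · rw [corner_injective d h1, corner_injective d h2, localExt_inner, localExt_flip hd]

theorem armVertex_outer {n d : ℕ} (hn : 2 ≤ n) {x : ℝ} (hA : sumFactor n d x ≠ 0)
    (b : (Fin d → Fin 2) → ℝ) (i : Fin d → Fin 2) :
    armVertex d x (centreValue n d x b i) (centreSum n d x b) (n - 1) = b i := by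
  rw [armVertex, show ((n - 1 : ℕ) : ℤ) = (n : ℤ) - 1 by omega,
    show (n : ℤ) - 1 - 1 = n - 2 by ring]
  have : sumFactor n d x * centreValue n d x b i =
      b i + (1 + tVal d x) * chebU d (n - 2) x * centreSum n d x b := by
    rw [centreValue]; field_simp
  rw [sumFactor] at this
  linarith

theorem localExt_corner {n d : ℕ} (hn : 2 ≤ n) (hd : 2 ≤ d) {x : ℝ} (hA : sumFactor n d x ≠ 0)
    (b : (Fin d → Fin 2) → ℝ) {a : Letter n d} {e e' : Fin d → Fin 2}
    (h : letterMap n d a (corner e) = corner e') : localExt n d x b a e = b e' := by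
  rw [localExt_congr hn hd x b (h.trans (letterMap_outer hn e').symm)]
  simp only [localExt, if_true]
  rw [show n - 2 + 1 = n - 1 by omega]
  exact armVertex_outer hn hA b e'

theorem sum_localExt_arm {n d : ℕ} (hd : 2 ≤ d) (x : ℝ) (b : (Fin d → Fin 2) → ℝ)
    (i : Fin d → Fin 2) (r : Fin (n - 1)) :
    ∑ e, localExt n d x b (some (i, r)) e = (2 ^ d - 1 + tVal d x) *
      armFree d x (centreValue n d x b i) (centreSum n d x b) (r + 1) := by
  set v := centreValue n d x b i with hv
  set s := centreSum n d x b with hs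
  have h : ∑ e, (localExt n d x b (some (i, r)) e - armFree d x v s (r + 1)) =
      (armVertex d x v s (r + 1) - armFree d x v s (r + 1)) +
        (armVertex d x v s r - armFree d x v s (r + 1)) := by
    rw [Fintype.sum_eq_add i (flip i) (flip_ne hd i).symm]
    · rw [localExt_flip hd]
      simp [localExt, ← hv, ← hs]
    · rintro e ⟨h1, h2⟩
      simp [localExt, h1, h2, ← hv, ← hs]
  rw [Finset.sum_sub_distrib] at h
  simp only [Finset.sum_const, Finset.card_univ, Fintype.card_fun, Fintype.card_fin,
    nsmul_eq_mul] at h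
  push_cast at h
  linear_combination h + armVertex_succ d x v s r

/-- The cell at distance `k` from the centre, on the arm towards `i`. -/
def armLetter {n d : ℕ} (i : Fin d → Fin 2) (k : ℕ) : Letter n d :=
  if h : 1 ≤ k ∧ k ≤ n - 1 then some (i, ⟨k - 1, by omega⟩) else none

theorem armLetter_succ {n d : ℕ} (i : Fin d → Fin 2) (r : Fin (n - 1)) :
    (armLetter i (r + 1) : Letter n d) = some (i, r) := by
  rw [armLetter, dif_pos ⟨by omega, by omega⟩]
  simp

theorem armLetter_eq_inner {n d : ℕ} (i : Fin d → Fin 2) (r : Fin (n - 1)) :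
    (armLetter i r : Letter n d) = inner i r := by
  unfold armLetter inner
  by_cases h : (r : ℕ) = 0
  · simp [h]
  · rw [dif_pos ⟨by omega, by omega⟩, if_neg h]

/-- The origin of `R`: by the Pell identity, the failure of the equation at the outer end of an arm
has the shape of the one-cell equation for `b`, with `R(x)` as eigenvalue. -/
theorem defect_eq {n d : ℕ} (hn : 2 ≤ n) {x : ℝ} (hA : sumFactor n d x ≠ 0)
    (hQ : topFactor n d x ≠ 0) (b : (Fin d → Fin 2) → ℝ) (i : Fin d → Fin 2) :
    armFree d x (centreValue n d x b i) (centreSum n d x b) (n - 1) - b i =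
      (sumFactor n d x * topFactor n d x)⁻¹ *
        (∑ e, b e - (2 ^ d - (2 ^ d - 1) * (decimation n d).eval x) * b i) := by
  have hpell := chebU_pell d n x
  have hT : ∑ e, b e = topFactor n d x * centreSum n d x b := by
    rw [centreSum]; field_simp
  have hv : sumFactor n d x * centreValue n d x b i =
      b i + (1 + tVal d x) * chebU d (n - 2) x * centreSum n d x b := by
    rw [centreValue]; field_simp
  rw [decimation_top, hT, eq_inv_mul_iff_mul_eq₀ (mul_ne_zero hA hQ), armFree,
    show ((n - 1 : ℕ) : ℤ) = (n : ℤ) - 1 by omega, show (n : ℤ) - 1 - 1 = n - 2 by ring]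
  set s := centreSum n d x b
  set v := centreValue n d x b i
  set q := topFactor n d x
  rw [diffFactor]
  rw [sumFactor] at hv ⊢
  linear_combination (2 * chebU d (n - 2) x * q) * hv + s * q * hpell

/-- The defects of the eigenvalue equation for the extension are concentrated at the corners, where
they are proportional to the defects for `b` and the value `R(x)`. -/
theorem sum_localExt_defect {n d : ℕ} (hn : 2 ≤ n) (hd : 2 ≤ d) {x : ℝ}
    (hA : sumFactor n d x ≠ 0) (hQ : topFactor n d x ≠ 0) (b : (Fin d → Fin 2) → ℝ)
    (φ : (Fin d → ℝ) → ℝ) :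
    ∑ a : Letter n d, ∑ e, φ (letterMap n d a (corner e)) *
        (∑ e', localExt n d x b a e' - (2 ^ d - 1 + tVal d x) * localExt n d x b a e) =
      (2 ^ d - 1 + tVal d x) * (sumFactor n d x * topFactor n d x)⁻¹ *
        ∑ e, φ (corner e) *
          (∑ e', b e' - (2 ^ d - (2 ^ d - 1) * (decimation n d).eval x) * b e) := by
  set N := (2 : ℝ) ^ d - 1 + tVal d x with hN
  set s := centreSum n d x b with hs
  -- `X i k` is the weighted defect at the outer corner of the `k`-th cell. By `armFree_succ` the
  -- next cell contributes its negative at the same point, free vertices contribute nothing, and the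
  -- sum telescopes to the outermost corner.
  let X (i : Fin d → Fin 2) (k : ℕ) : ℝ := φ (letterMap n d (armLetter i k) (corner i)) *
    (N * (armFree d x (centreValue n d x b i) s k - armVertex d x (centreValue n d x b i) s k))
  have hsome (i : Fin d → Fin 2) (r : Fin (n - 1)) :
      ∑ e, φ (letterMap n d (some (i, r)) (corner e)) *
        (∑ e', localExt n d x b (some (i, r)) e' - N * localExt n d x b (some (i, r)) e) =
      X i (r + 1) - X i r := by
    rw [sum_localExt_arm hd, Fintype.sum_eq_add i (flip i) (flip_ne hd i).symm]
    · rw [localExt_flip hd, letterMap_inner hn, ← armLetter_eq_inner]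
      simp only [X, armLetter_succ]
      have := armFree_succ d x (centreValue n d x b i) s r
      simp only [localExt, if_true, ← hs, ← hN]
      linear_combination φ (letterMap n d (armLetter i r) (corner i)) * N * this
    · rintro e ⟨h1, h2⟩
      simp [localExt, h1, h2, ← hs, ← hN]
  have hnone : ∑ e, φ (letterMap n d none (corner e)) *
        (∑ e', localExt n d x b none e' - N * localExt n d x b none e) = ∑ i, X i 0 := by
    refine Finset.sum_congr rfl fun i _ => ?_
    simp only [X, localExt, armFree_zero, armVertex_zero]
    rw [sum_centreValue hA hQ, ← hs, ← hN, mul_sub N]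
    simp [armLetter]
  have hlast (i : Fin d → Fin 2) : X i (n - 1) = N * (sumFactor n d x * topFactor n d x)⁻¹ *
      (φ (corner i) * (∑ e', b e' - (2 ^ d - (2 ^ d - 1) * (decimation n d).eval x) * b i)) := by
    have h := armLetter_succ (n := n) i ⟨n - 2, by omega⟩
    simp only [show n - 2 + 1 = n - 1 by omega] at h
    simp only [X]
    rw [h, letterMap_outer hn, armVertex_outer hn hA, defect_eq hn hA hQ]
    ring
  rw [Fintype.sum_option, hnone, Fintype.sum_prod_type, ← Finset.sum_add_distrib, Finset.mul_sum]
  refine Finset.sum_congr rfl fun i _ => ?_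
  simp only [hsome]
  rw [← hlast, ← Finset.sum_range (fun k => X i (k + 1) - X i k), Finset.sum_range_sub]
  ring

/-! ### Spectral decimation on the whole graph. -/

/-- The extension of a function on `V_m` to `V_{m+1}`, in terms of addresses. -/
def cellExt {n d : ℕ} (hn : 2 ≤ n) {m : ℕ} (x : ℝ) (f : vertices n d m → ℝ)
    (w : Fin m → Letter n d) : Letter n d → (Fin d → Fin 2) → ℝ :=
  localExt n d x fun e => f (vert hn m w e)

/-- Extensions from different level-`m` cells can only conflict at common corners of those cells,
where both reproduce the value of `f`. -/
theorem cellExt_congr {n d : ℕ} (hn : 2 ≤ n) (hd : 2 ≤ d) {m : ℕ} {x : ℝ}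
    (hA : sumFactor n d x ≠ 0) (f : vertices n d m → ℝ) {w w' : Fin m → Letter n d}
    {a a' : Letter n d} {e e' : Fin d → Fin 2}
    (h : cellMap n d m w (letterMap n d a (corner e)) =
      cellMap n d m w' (letterMap n d a' (corner e'))) :
    cellExt hn x f w a e = cellExt hn x f w' a' e' := by
  by_cases hw : w = w'
  · subst hw
    exact localExt_congr hn hd x _ (cellMap_injective hn m w h)
  · obtain ⟨g, g', hg⟩ := cellMap_touch_unique hn hd hw
    obtain ⟨h1, h2⟩ := hg _ (letterMap_mem_cube hn a (corner_mem_cube e)) _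
      (letterMap_mem_cube hn a' (corner_mem_cube e')) h
    rw [cellExt, cellExt, localExt_corner hn hd hA _ h1, localExt_corner hn hd hA _ h2]
    congr 1
    rw [vert_eq_iff, ← h1, ← h2, h]

theorem exists_extension {n d : ℕ} (hn : 2 ≤ n) (hd : 2 ≤ d) {m : ℕ} {x : ℝ}
    (hA : sumFactor n d x ≠ 0) (f : vertices n d m → ℝ) :
    ∃ g : vertices n d (m + 1) → ℝ,
      ∀ w a e, g (vert hn (m + 1) (Fin.snoc w a) e) = cellExt hn x f w a e := by
  choose W E hWE using fun y : vertices n d (m + 1) => vert_surjective hn y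
  refine ⟨fun y => cellExt hn x f (Fin.init (W y)) (W y (Fin.last m)) (E y), fun w a e => ?_⟩
  apply cellExt_congr hn hd hA
  rw [← cellMap_succ', ← cellMap_snoc]
  exact (vert_eq_iff hn).1 (hWE _)

theorem vertices_subset_succ {n d : ℕ} (hn : 2 ≤ n) (m : ℕ) :
    vertices n d m ⊆ vertices n d (m + 1) := by
  intro x hx
  obtain ⟨w, e, rfl⟩ := (mem_vertices_iff hn).1 hx
  refine (mem_vertices_iff hn).2 ⟨Fin.snoc w (some (e, ⟨n - 2, by omega⟩)), e, ?_⟩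
  rw [cellMap_snoc, letterMap_outer hn]

theorem sum_snoc {α : Type*} [Fintype α] {m : ℕ} (F : (Fin (m + 1) → α) → ℝ) :
    ∑ w, F w = ∑ w : Fin m → α, ∑ a, F (Fin.snoc w a) := by
  rw [← (Fin.snocEquiv fun _ => α).sum_comp, Fintype.sum_prod_type, Finset.sum_comm]
  rfl

-- Testing `sum_localExt_defect` against the indicator of `y` in each cell gives a common factor `κ`
-- times the defect of `f` at `y`; at a new vertex no old corner is hit and the sum is empty.
open Classical in
theorem extension_mem_eigenspace {n d : ℕ} (hn : 2 ≤ n) (hd : 2 ≤ d) {m : ℕ} {x : ℝ}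
    (hA : sumFactor n d x ≠ 0) (hQ : topFactor n d x ≠ 0) {f : vertices n d m → ℝ}
    (hf : f ∈ Module.End.eigenspace (-laplacian n d m) ((decimation n d).eval x))
    {g : vertices n d (m + 1) → ℝ}
    (hg : ∀ w a e, g (vert hn (m + 1) (Fin.snoc w a) e) = cellExt hn x f w a e) :
    g ∈ Module.End.eigenspace (-laplacian n d (m + 1)) x := by
  rw [mem_eigenspace_iff hn hd] at hf ⊢
  intro y
  set κ := (2 ^ d - 1 + tVal d x) * (sumFactor n d x * topFactor n d x)⁻¹ with hκ
  have ht : (2 : ℝ) ^ d - (2 ^ d - 1) * x = 2 ^ d - 1 + tVal d x := by rw [tVal]; ring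
  have hcell (w : Fin m → Letter n d) :
      ∑ a, ∑ e, (if vert hn (m + 1) (Fin.snoc w a) e = y then
          cellSum hn g (Fin.snoc w a) - (2 ^ d - (2 ^ d - 1) * x) * g y else 0) =
        κ * ∑ e, (if cellMap n d m w (corner e) = y then cellSum hn f w -
          (2 ^ d - (2 ^ d - 1) * (decimation n d).eval x) * f (vert hn m w e) else 0) := by
    have h := sum_localExt_defect hn hd hA hQ (fun e => f (vert hn m w e))
      (fun p => if cellMap n d m w p = y then 1 else 0)
    simp only [ite_mul, one_mul, zero_mul] at h
    rw [cellSum, hκ, ← h]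
    refine Finset.sum_congr rfl fun a _ => Finset.sum_congr rfl fun e _ => ?_
    have hiff : vert hn (m + 1) (Fin.snoc w a) e = y ↔
        cellMap n d m w (letterMap n d a (corner e)) = y := by
      rw [← cellMap_snoc]
      exact Subtype.ext_iff
    by_cases hy : vert hn (m + 1) (Fin.snoc w a) e = y
    · rw [if_pos hy, if_pos (hiff.1 hy), ← hy, hg, ht, cellSum]
      simp only [hg, cellExt]
    · rw [if_neg hy, if_neg (fun h => hy (hiff.2 h))]
  rw [sum_snoc]
  simp only [hcell]
  rw [← Finset.mul_sum]
  by_cases hy : (y : Fin d → ℝ) ∈ vertices n d m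
  · have h0 := hf ⟨y, hy⟩
    have : ∑ w, ∑ e, (if cellMap n d m w (corner e) = y then cellSum hn f w -
        (2 ^ d - (2 ^ d - 1) * (decimation n d).eval x) * f (vert hn m w e) else 0) = 0 := by
      refine Eq.trans ?_ h0
      refine Finset.sum_congr rfl fun w _ => Finset.sum_congr rfl fun e _ => ?_
      have hiff : vert hn m w e = ⟨y, hy⟩ ↔ cellMap n d m w (corner e) = y :=
        Subtype.ext_iff
      by_cases hy' : vert hn m w e = ⟨y, hy⟩
      · rw [if_pos hy', if_pos (hiff.1 hy'), hy']
      · rw [if_neg hy', if_neg (fun h => hy' (hiff.2 h))]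
    rw [this, mul_zero]
  · have (w : Fin m → Letter n d) (e : Fin d → Fin 2) : cellMap n d m w (corner e) ≠ y :=
      fun h => hy ((mem_vertices_iff hn).2 ⟨w, e, h⟩)
    simp [this]

/-- Spectral decimation: at regular values `x`, eigenfunctions for `R(x)` extend to eigenfunctions
for `x` on the next level. -/
theorem multiplicity_decimation_le {n d : ℕ} (hn : 2 ≤ n) (hd : 2 ≤ d) (m : ℕ) {x : ℝ}
    (hA : sumFactor n d x ≠ 0) (hQ : topFactor n d x ≠ 0) :
    neumannMultiplicity n d m ((decimation n d).eval x) ≤ neumannMultiplicity n d (m + 1) x := by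
  -- Restriction to `V_m` is used instead of a linear extension operator: extensions need only
  -- exist, and the image under a linear map cannot have larger dimension.
  let ρ := LinearMap.funLeft ℝ ℝ (Set.inclusion (vertices_subset_succ (d := d) hn m))
  have hle : Module.End.eigenspace (-laplacian n d m) ((decimation n d).eval x) ≤
      (Module.End.eigenspace (-laplacian n d (m + 1)) x).map ρ := by
    intro f hf
    obtain ⟨g, hg⟩ := exists_extension hn hd hA f
    refine ⟨g, extension_mem_eigenspace hn hd hA hQ hf hg, ?_⟩
    funext y
    obtain ⟨w, e, rfl⟩ := vert_surjective hn y
    have : Set.inclusion (vertices_subset_succ (d := d) hn m) (vert hn m w e) =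
        vert hn (m + 1) (Fin.snoc w (some (e, ⟨n - 2, by omega⟩))) e := by
      apply Subtype.ext
      simp only [vert, cellMap_snoc, letterMap_outer hn]
    rw [LinearMap.funLeft_apply, this, hg, cellExt]
    exact localExt_corner hn hd hA _ (letterMap_outer hn e)
  exact (Submodule.finrank_mono hle).trans (Submodule.finrank_map_le _ _)

/-! ### The dimension count. -/

theorem sum_finrank_eigenspace_le {V ι : Type*} [AddCommGroup V] [Module ℝ V] [FiniteDimensional ℝ V]
    [Fintype ι] (T : Module.End ℝ V) {μ : ι → ℝ} (hμ : Function.Injective μ) :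
    ∑ i, Module.finrank ℝ (Module.End.eigenspace T (μ i)) ≤ Module.finrank ℝ V := by
  classical
  have hind := (Module.End.eigenspaces_iSupIndep T).comp hμ
  have hinj := hind.dfinsupp_lsum_injective
  have h := LinearMap.finrank_le_finrank_of_injective hinj
  refine le_trans (le_of_eq ?_) h
  exact (Module.finrank_directSum (R := ℝ)
    fun i => (Module.End.eigenspace T (μ i) : Submodule ℝ V)).symm

theorem mem_neumannSpectrum_iff {n d m : ℕ} {μ : ℝ} :
    μ ∈ neumannSpectrum n d m ↔ 1 ≤ neumannMultiplicity n d m μ := by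
  have hiff (f : vertices n d m → ℝ) : (∀ x, -(laplacian n d m f x) = μ * f x) ↔
      f ∈ Module.End.eigenspace (-laplacian n d m) μ := by
    rw [Module.End.mem_eigenspace_iff, funext_iff]
    rfl
  constructor
  · rintro ⟨f, hf, h⟩
    exact one_le_multiplicity hf ((hiff f).1 h)
  · intro h
    rw [neumannMultiplicity, Nat.one_le_iff_ne_zero, Ne, Submodule.finrank_eq_zero] at h
    obtain ⟨f, hf, h0⟩ := Submodule.exists_mem_ne_zero_of_ne_bot h
    exact ⟨f, h0, (hiff f).2 hf⟩

theorem multiplicity_branchWord_ge {n d : ℕ} (hn : 2 ≤ n) (hd : 2 ≤ d) {s : Bool}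
    (v : List (Fin (2 * n - 1))) (hv : v ∈ admissible n s) (m : ℕ) :
    neumannMultiplicity n d m (seed d s) ≤
      neumannMultiplicity n d (m + v.length) (branchWord n d v (seed d s)) := by
  induction v using List.reverseRecOn with
  | nil => exact le_rfl
  | append_singleton u l ih =>
    obtain ⟨hA, hQ⟩ := regular_of_admissible hn hd hv
    refine (ih (admissible_of_concat hv)).trans ?_
    have h := multiplicity_decimation_le hn hd (m + u.length) hA hQ
    rw [branchWord_concat, decimation_branch hn hd (branchWord_mem hn hd u (seed_mem hd s))] at h
    rw [branchWord_concat]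
    simpa [add_assoc] using h

/-- The multiplicity predicted for the eigenvalue reached from a seed by a word of length `l`. -/
def predicted (n d m : ℕ) (s : Bool) (l : ℕ) : ℕ :=
  if s then (2 ^ d * n - 2 ^ d + 1) ^ (m - l) * (2 ^ d - 2) + 1 else 1

theorem predicted_le {n d : ℕ} (hn : 2 ≤ n) (hd : 2 ≤ d) {s : Bool}
    (v : List (Fin (2 * n - 1))) (hv : v ∈ admissible n s) {m : ℕ} (hm : v.length ≤ m) :
    predicted n d m s v.length ≤ neumannMultiplicity n d m (branchWord n d v (seed d s)) := by
  have h := multiplicity_branchWord_ge hn hd v hv (m - v.length)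
  rw [Nat.sub_add_cancel hm] at h
  refine le_trans ?_ h
  cases s with
  | true => exact le_multiplicity_top hn hd _
  | false => exact one_le_multiplicity_zero hn hd _

/-- Since the predicted multiplicities exhaust the dimension, a further eigenvalue or a larger
multiplicity is impossible. -/
theorem spectrum_and_multiplicity {n d : ℕ} (hn : 2 ≤ n) (hd : 2 ≤ d) (m : ℕ) :
    (∀ s, ∀ v ∈ admissible n s, v.length ≤ m →
      neumannMultiplicity n d m (branchWord n d v (seed d s)) = predicted n d m s v.length) ∧
    ∀ μ ∈ neumannSpectrum n d m, ∃ s, ∃ v ∈ admissible n s, v.length ≤ m ∧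
      μ = branchWord n d v (seed d s) := by
  classical
  let wd (p : WordIndex n m ⊕ WordIndex n m) : Bool × List (Fin (2 * n - 1)) :=
    p.elim (fun i => (true, indexWord n m true i)) (fun i => (false, indexWord n m false i))
  have hadm (p) : (wd p).2 ∈ admissible n (wd p).1 := by
    rcases p with i | i <;> exact indexWord_admissible _ i
  have hlen (p) : (wd p).2.length ≤ m := by
    rcases p with i | i <;> exact indexWord_length_le _ i
  have hwd : Function.Injective wd := by
    rintro (i | i) (j | j) h <;> simp only [wd, Sum.elim_inl, Sum.elim_inr, Prod.mk.injEq,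
      reduceCtorEq, false_and, true_and] at h
    · rw [indexWord_injective n m true h]
    · rw [indexWord_injective n m false h]
  have hsurj (s) (v) (hv : v ∈ admissible n s) (hm : v.length ≤ m) : ∃ p, wd p = (s, v) := by
    obtain ⟨i, rfl⟩ := indexWord_surjective hn s v hv hm
    cases s with
    | true => exact ⟨Sum.inl i, rfl⟩
    | false => exact ⟨Sum.inr i, rfl⟩
  let ev (p : WordIndex n m ⊕ WordIndex n m) : ℝ := branchWord n d (wd p).2 (seed d (wd p).1)
  have hev : Function.Injective ev := fun p q h => by
    obtain ⟨h1, h2⟩ := branchWord_injective hn hd _ _ (hadm p) (hadm q) h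
    exact hwd (Prod.ext h1 h2)
  have hge (p) : predicted n d m (wd p).1 (wd p).2.length ≤ neumannMultiplicity n d m (ev p) :=
    predicted_le hn hd _ (hadm p) (hlen p)
  have htotal : ∑ p, predicted n d m (wd p).1 (wd p).2.length =
      Module.finrank ℝ (vertices n d m → ℝ) := by
    rw [card_vertices hn hd, ← sum_multiplicities hn hd m, Fintype.sum_sum_type]
    rfl
  constructor
  · intro s v hv hm
    obtain ⟨p, hp⟩ := hsurj s v hv hm
    have hle : ∑ p, neumannMultiplicity n d m (ev p) ≤
        ∑ p, predicted n d m (wd p).1 (wd p).2.length := by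
      rw [htotal]; exact sum_finrank_eigenspace_le _ hev
    have heq := (Finset.sum_eq_sum_iff_of_le fun p _ => hge p).1
      (le_antisymm (Finset.sum_le_sum fun p _ => hge p) hle) p (Finset.mem_univ p)
    simp only [ev, hp] at heq
    exact heq.symm
  · intro μ hμ
    by_contra hcon
    push Not at hcon
    have hne (p) : ev p ≠ μ := fun h => hcon _ _ (hadm p) (hlen p) h.symm
    -- An unlisted eigenvalue is adjoined as one more index; its multiplicity of at least `1` would
    -- push the sum beyond the dimension.
    have hev' : Function.Injective (fun o : Option (WordIndex n m ⊕ WordIndex n m) =>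
        o.elim μ ev) := by
      rintro (_ | p) (_ | q) h
      · rfl
      · exact absurd h.symm (hne q)
      · exact absurd h (hne p)
      · exact congrArg some (hev h)
    have h : ∑ o : Option (WordIndex n m ⊕ WordIndex n m), neumannMultiplicity n d m (o.elim μ ev) ≤
        Module.finrank ℝ (vertices n d m → ℝ) := sum_finrank_eigenspace_le _ hev'
    rw [Fintype.sum_option, ← htotal] at h
    have h1 := mem_neumannSpectrum_iff.1 hμ
    have h2 := Finset.sum_le_sum (s := Finset.univ) fun p _ => hge p
    simp only [Option.elim] at h
    omega

end Vicsek

end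

theorem theorem4p2 (n d : ℕ) (hn : 2 ≤ n) (hd : 2 ≤ d) :
    -- the inverse branches are well defined on `[0, 2^d/(2^d-1)]`, with values in `[0, 1]`
    (∀ y ∈ Set.Icc (0 : ℝ) ((2 : ℝ) ^ d / ((2 : ℝ) ^ d - 1)),
      StrictMono (fun l : Fin (2 * n - 1) => Vicsek.branch n d l y) ∧
      Set.range (fun l : Fin (2 * n - 1) => Vicsek.branch n d l y) =
        {x : ℝ | (Vicsek.decimation n d).eval x = y} ∧
      ∀ l : Fin (2 * n - 1), Vicsek.branch n d l y ∈ Set.Icc (0 : ℝ) 1) ∧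
    ∀ m : ℕ,
      -- the Neumann spectrum
      Vicsek.neumannSpectrum n d m =
        {μ : ℝ | ∃ v ∈ Vicsek.words n m, v ∈ Vicsek.firstKind n ∧
          μ = Vicsek.branchWord n d v ((2 : ℝ) ^ d / ((2 : ℝ) ^ d - 1))} ∪
        {μ : ℝ | ∃ v ∈ Vicsek.words n m, v ∈ Vicsek.secondKind n ∧
          μ = Vicsek.branchWord n d v 0} ∧
      -- the multiplicities
      (∀ v ∈ Vicsek.words n m, v ∈ Vicsek.firstKind n →
        Vicsek.neumannMultiplicity n d m
            (Vicsek.branchWord n d v ((2 : ℝ) ^ d / ((2 : ℝ) ^ d - 1))) =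
          (2 ^ d * n - 2 ^ d + 1) ^ (m - v.length) * (2 ^ d - 2) + 1) ∧
      (∀ v ∈ Vicsek.words n m, v ∈ Vicsek.secondKind n →
        Vicsek.neumannMultiplicity n d m (Vicsek.branchWord n d v 0) = 1) := by
  constructor
  · intro y hy
    exact ⟨Vicsek.branch_strictMono hn hd hy, (Vicsek.branch_spec hn hd hy).2,
      Vicsek.branch_mem_Icc hn hd hy⟩
  intro m
  obtain ⟨hmult, hspec⟩ := Vicsek.spectrum_and_multiplicity hn hd m
  have hmem (s : Bool) (v : List (Fin (2 * n - 1))) (hv : v ∈ Vicsek.admissible n s)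
      (hm : v.length ≤ m) :
      Vicsek.branchWord n d v (Vicsek.seed d s) ∈ Vicsek.neumannSpectrum n d m := by
    rw [Vicsek.mem_neumannSpectrum_iff, hmult s v hv hm, Vicsek.predicted]
    split <;> omega
  refine ⟨?_, fun v hm hv => hmult true v hv hm, fun v hm hv => hmult false v hv hm⟩
  ext μ
  constructor
  · intro hμ
    obtain ⟨s, v, hv, hm, rfl⟩ := hspec μ hμ
    cases s with
    | true => exact Or.inl ⟨v, hm, hv, rfl⟩
    | false => exact Or.inr ⟨v, hm, hv, rfl⟩
  · rintro (⟨v, hm, hv, rfl⟩ | ⟨v, hm, hv, rfl⟩)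
    · exact hmem true v hv hm
    · exact hmem false v hv hm
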